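/- Let $\mathcal A$ be a complete abelian category satisfying AB5 (so $\mathcal A$ is cocomplete and filtered colimits in $\mathcal A$ are exact). Let $\mathcal X,\mathcal Y$ be full subcategories of $\mathcal A$ closed under isomorphisms and finite direct sums, with $\mathcal X$ also closed under direct summands. A complex $K$ is called right $\mathcal X$-acyclic if $\mathrm{Hom}_{\mathcal A}(X,K)$ is acyclic for all $X\in\mathcal X$, and left $\mathcal Y$-acyclic if $\mathrm{Hom}_{\mathcal A}(K,Y)$ is acyclic for all $Y\in\mathcal Y$. A right $\mathcal X$-approximation of $M\in\mathcal A$ is a morphism $X\to M$ with $X\in\mathcal X$ through which every morphism from an object of $\mathcal X$ to $M$ factors; a left $\mathcal Y$-approximation of $M$ is a morphism $M\to Y$ with $Y\in\mathcal Y$ through which every morphism from $M$ to an object of $\mathcal Y$ factors. Assume that $(\mathcal X,\mathcal Y)$ is an admissible balanced pair, that is: (1) every object of $\mathcal A$ has a right $\mathcal X$-approximation and a left $\mathcal Y$-approximation; (2) for every $M\in\mathcal A$ there is a complex $\cdots\to X_1\to X_0\to M\to 0$ with all $X_i\in\mathcal X$ which is both right $\mathcal X$-acyclic and left $\mathcal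 Y$-acyclic; (3) for every $N\in\mathcal A$ there is a complex $0\to N\to Y_0\to Y_1\to\cdots$ with all $Y_i\in\mathcal Y$ which is both right $\mathcal X$-acyclic and left $\mathcal Y$-acyclic; (4) every right $\mathcal X$-approximation is an epimorphism and every left $\mathcal Y$-approximation is a monomorphism. Let $\mathcal E$ be the class of short exact sequences in $\mathcal A$ that are right $\mathcal X$-acyclic, and let $\mathrm{Ch}(\mathcal A,\mathcal E)$ be the exact category of $\mathbb Z$-indexed chain complexes in $\mathcal A$ whose short exact sequences are those lying degreewise in $\mathcal E$. Write $\mathrm{Ext}^1$ for its Yoneda $\mathrm{Ext}$, and for a class $\mathcal F$ of complexes let $\mathcal F^{\perp}$ (respectively ${}^{\perp}\mathcal F$) be the class of all complexes $C$ with $\mathrm{Ext}^1(F,C)=0$ (respectively $\mathrm{Ext}^1(C,F)=0$) for all $F\in\mathcal F$. Let $\mathcal E\text{-dw}\widetilde{\mathcal X}$ be the class of complexes with all terms in $\mathcal X$, and $\mathcal E\text{-ac}\widetilde{\mathcal X}$ the class of right $\mathcal X$-acyclic complexes with all terms in $\mathcal X$. If $(\mathcal E\text{-dw}\widetilde{\mathcal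 X})^{\perp}$ is closed under (small) direct sums, then $(\mathcal E\text{-ac}\widetilde{\mathcal X},(\mathcal E\text{-ac}\widetilde{\mathcal X})^{\perp})$ is a complete cotorsion pair in $\mathrm{Ch}(\mathcal A,\mathcal E)$. That is, writing $\mathcal F=\mathcal E\text{-ac}\widetilde{\mathcal X}$ and $\mathcal C=\mathcal F^{\perp}$, one has $\mathcal F={}^{\perp}\mathcal C$, and for every complex $M$ there are short exact sequences $C\rightarrowtail F\twoheadrightarrow M$ and $M\rightarrowtail C'\twoheadrightarrow F'$ in $\mathrm{Ch}(\mathcal A,\mathcal E)$ with $F,F'\in\mathcal F$ and $C,C'\in\mathcal C$. -/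

import Mathlib

open CategoryTheory CategoryTheory.Limits

universe w v u

/-! ### Exact categories in the sense of Quillen -/

section ExactCategories

variable {C : Type u} [Category.{v} C] [Preadditive C]

/-- `f` is an admissible monomorphism for the class `E` of short sequences: it is the first
morphism of a sequence in `E`. -/
def IsAdmissibleMono (E : ObjectProperty (ShortComplex C)) {A B : C} (f : A ⟶ B) : Prop :=
  ∃ (Z : C) (g : B ⟶ Z) (zero : f ≫ g = 0), E (ShortComplex.mk f g zero)

/-- `g` is an admissible epimorphism for the class `E` of short sequences: it is the second
morphism of a sequence in `E`. -/
def IsAdmissibleEpi (E : ObjectProperty (ShortComplex C)) {B Z : C} (g : B ⟶ Z) : Prop :=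
  ∃ (A : C) (f : A ⟶ B) (zero : f ≫ g = 0), E (ShortComplex.mk f g zero)

variable (C) in
/-- A Quillen exact structure: an isomorphism-closed class of kernel-cokernel pairs
(the "short exact sequences" of the exact category) which satisfies the usual axioms. -/
structure QuillenExactStructure where
  /-- the class of short exact sequences of the exact category -/
  conflation : ObjectProperty (ShortComplex C)
  closedUnderIso : conflation.IsClosedUnderIsomorphisms
  isKernel : ∀ S, conflation S → Nonempty (IsLimit (KernelFork.ofι S.f S.zero))
  isCokernel : ∀ S, conflation S → Nonempty (IsColimit (CokernelCofork.ofπ S.g S.zero))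
  id_admissibleMono : ∀ A : C, IsAdmissibleMono conflation (𝟙 A)
  id_admissibleEpi : ∀ A : C, IsAdmissibleEpi conflation (𝟙 A)
  comp_admissibleMono : ∀ {A B D : C} (f : A ⟶ B) (g : B ⟶ D),
    IsAdmissibleMono conflation f → IsAdmissibleMono conflation g →
      IsAdmissibleMono conflation (f ≫ g)
  comp_admissibleEpi : ∀ {A B D : C} (f : A ⟶ B) (g : B ⟶ D),
    IsAdmissibleEpi conflation f → IsAdmissibleEpi conflation g →
      IsAdmissibleEpi conflation (f ≫ g)
  pushout_admissibleMono : ∀ {A B A' : C} (i : A ⟶ B) (a : A ⟶ A'),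
    IsAdmissibleMono conflation i → ∃ (B' : C) (b : B ⟶ B') (i' : A' ⟶ B'),
      IsPushout i a b i' ∧ IsAdmissibleMono conflation i'
  pullback_admissibleEpi : ∀ {B Z Z' : C} (p : B ⟶ Z) (z : Z' ⟶ Z),
    IsAdmissibleEpi conflation p → ∃ (B' : C) (b : B' ⟶ B) (p' : B' ⟶ Z'),
      IsPullback b p' p z ∧ IsAdmissibleEpi conflation p'

namespace QuillenExactStructure

variable (E : QuillenExactStructure C)

/-- A short exact sequence `N ↣ mid ↠ M` of the exact category. -/
structure Extension (M N : C) where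
  /-- the middle term -/
  mid : C
  /-- the admissible monomorphism -/
  ι : N ⟶ mid
  /-- the admissible epimorphism -/
  π : mid ⟶ M
  zero : ι ≫ π = 0
  conflation : E.conflation (ShortComplex.mk ι π zero)

/-- Two extensions of `M` by `N` are equivalent if there is an isomorphism of the middle terms
which is compatible with the identities of `M` and `N`. -/
instance extensionSetoid (M N : C) : Setoid (E.Extension M N) where
  r e e' := ∃ φ : e.mid ≅ e'.mid, e.ι ≫ φ.hom = e'.ι ∧ φ.hom ≫ e'.π = e.π
  iseqv :=
    { refl := fun e => ⟨Iso.refl _, by simp, by simp⟩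
      symm := by
        rintro e e' ⟨φ, h₁, h₂⟩
        exact ⟨φ.symm, by simp [← h₁], by simp [← h₂]⟩
      trans := by
        rintro e e' e'' ⟨φ, h₁, h₂⟩ ⟨ψ, h₃, h₄⟩
        exact ⟨φ ≪≫ ψ, by simp [reassoc_of% h₁, h₃], by simp [h₄, h₂]⟩ }

/-- The Yoneda `Ext¹` of an exact category: the equivalence classes of extensions of `M` by `N`.
Its zero element is the class of the split extension, so that `Ext¹` vanishes
if and only if it has at most one element. -/
def ExtOne (M N : C) : Type (max u v) := Quotient (E.extensionSetoid M N)

/-- The right orthogonal class `P^⊥`: all `N` with `Ext¹(M, N) = 0` for every `M` in `P`. -/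
def rightOrthogonal (P : ObjectProperty C) : ObjectProperty C :=
  fun N => ∀ M : C, P M → Subsingleton (E.ExtOne M N)

/-- The left orthogonal class `^⊥P`: all `M` with `Ext¹(M, N) = 0` for every `N` in `P`. -/
def leftOrthogonal (P : ObjectProperty C) : ObjectProperty C :=
  fun M => ∀ N : C, P N → Subsingleton (E.ExtOne M N)

/-- `(F, G)` is a cotorsion pair: `F = ^⊥G` and `G = F^⊥`. -/
structure IsCotorsionPair (F G : ObjectProperty C) : Prop where
  left_eq : F = E.leftOrthogonal G
  right_eq : G = E.rightOrthogonal F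

/-- A cotorsion pair `(F, G)` is complete if every object `M` has short exact sequences
`G₀ ↣ F₀ ↠ M` and `M ↣ G₁ ↠ F₁` with `F₀, F₁` in `F` and `G₀, G₁` in `G`. -/
structure IsCompleteCotorsionPair (F G : ObjectProperty C) : Prop
    extends E.IsCotorsionPair F G where
  exists_precover : ∀ M : C, ∃ (G₀ F₀ : C) (i : G₀ ⟶ F₀) (p : F₀ ⟶ M) (zero : i ≫ p = 0),
    F F₀ ∧ G G₀ ∧ E.conflation (ShortComplex.mk i p zero)
  exists_preenvelope : ∀ M : C, ∃ (G₁ F₁ : C) (i : M ⟶ G₁) (p : G₁ ⟶ F₁) (zero : i ≫ p = 0),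
    F F₁ ∧ G G₁ ∧ E.conflation (ShortComplex.mk i p zero)

end QuillenExactStructure

end ExactCategories

/-! ### A criterion for exact structures on abelian categories

The short exact sequences of an abelian category which stay short exact under a family of left
exact functors to abelian groups form an exact structure. -/

namespace ExactOfFunctors

variable {D : Type u} [Category.{v} D] [Abelian D] {ι : Type*} {F : ι → D ⥤ AddCommGrpCat.{w}}
  [∀ i, (F i).PreservesZeroMorphisms] [∀ i, PreservesFiniteLimits (F i)]
  {P : ObjectProperty (ShortComplex D)}

set_option linter.unusedSectionVars false in
lemma admissibleEpi_iff (hP : ∀ S, P S ↔ S.ShortExact ∧ ∀ i, Epi ((F i).map S.g))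
    {B Z : D} (g : B ⟶ Z) :
    IsAdmissibleEpi P g ↔ Epi g ∧ ∀ i, Epi ((F i).map g) := by
  constructor
  · rintro ⟨A, f, zero, h⟩
    rw [hP] at h
    exact ⟨h.1.epi_g, h.2⟩
  · rintro ⟨h, h'⟩
    refine ⟨kernel g, kernel.ι g, kernel.condition g, (hP _).2 ⟨?_, h'⟩⟩
    exact { exact := ShortComplex.exact_kernel g, mono_f := by dsimp; infer_instance, epi_g := h }

set_option linter.unusedSectionVars false in
lemma admissibleMono_iff (hP : ∀ S, P S ↔ S.ShortExact ∧ ∀ i, Epi ((F i).map S.g))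
    {A B : D} (f : A ⟶ B) :
    IsAdmissibleMono P f ↔ Mono f ∧ ∀ i, Epi ((F i).map (cokernel.π f)) := by
  constructor
  · rintro ⟨Z, g, zero, h⟩
    rw [hP] at h
    refine ⟨h.1.mono_f, fun i => ?_⟩
    have := h.2 i
    have hg : Epi g := h.1.epi_g
    obtain ⟨k, he⟩ : ∃ k, g ≫ k = cokernel.π f :=
      h.1.exact.desc' (cokernel.π f) (cokernel.condition f)
    have hiso : IsIso k := by
      refine ⟨cokernel.desc f g zero, ?_, ?_⟩
      · rw [← cancel_epi g, reassoc_of% he]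
        simp
      · rw [← cancel_epi (cokernel.π f)]
        simp [he]
    rw [← he, Functor.map_comp]
    exact epi_comp _ _
  · rintro ⟨h, h'⟩
    refine ⟨cokernel f, cokernel.π f, cokernel.condition f, (hP _).2 ⟨?_, h'⟩⟩
    exact { exact := ShortComplex.exact_cokernel f, mono_f := h, epi_g := by dsimp; infer_instance }

lemma admissibleMono_comp (hP : ∀ S, P S ↔ S.ShortExact ∧ ∀ i, Epi ((F i).map S.g))
    {A B Z : D} (f : A ⟶ B) (g : B ⟶ Z) (hf : IsAdmissibleMono P f) (hg : IsAdmissibleMono P g) :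
    IsAdmissibleMono P (f ≫ g) := by
  rw [admissibleMono_iff hP] at hf hg ⊢
  obtain ⟨_, hf⟩ := hf
  obtain ⟨_, hg⟩ := hg
  refine ⟨mono_comp _ _, fun i => ?_⟩
  have := hf i
  have := hg i
  let S₁ : ShortComplex D := ShortComplex.mk g (cokernel.π g) (cokernel.condition g)
  let S₂ : ShortComplex D := ShortComplex.mk
    (cokernel.map f (f ≫ g) (𝟙 _) g (by simp)) (cokernel.map (f ≫ g) g f (𝟙 _) (by simp))
    (kernelCokernelCompSequence.snakeInput f g).L₃.zero
  have hexact : S₂.Exact := (kernelCokernelCompSequence.snakeInput f g).L₃_exact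
  have hmono : Mono S₂.f :=
    (kernelCokernelCompSequence.snakeInput f g).L₂'_exact.mono_g
      (IsZero.eq_of_src (isZero_kernel_of_mono g) _ _)
  have hfac : cokernel.π (f ≫ g) ≫ cokernel.map (f ≫ g) g f (𝟙 _) (by simp) = cokernel.π g := by
    simp [cokernel.map]
  let φ : S₁ ⟶ S₂ :=
    { τ₁ := cokernel.π f
      τ₂ := cokernel.π (f ≫ g)
      τ₃ := 𝟙 _
      comm₁₂ := by simp [S₁, S₂, cokernel.map]
      comm₂₃ := by simp [S₁, S₂, cokernel.map] }
  have hS₂ : (S₂.map (F i)).Exact :=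
    hexact.map_of_mono_of_preservesKernel (F i) hmono inferInstance
  have h₁ : Epi ((F i).mapShortComplex.obj S₁).g := hg i
  have h₂ : Epi ((F i).mapShortComplex.obj S₂).g := by
    have : Epi ((F i).map (cokernel.π (f ≫ g)) ≫
        (F i).map (cokernel.map (f ≫ g) g f (𝟙 _) (by simp))) := by
      rw [← Functor.map_comp, hfac]
      exact hg i
    exact epi_of_epi ((F i).map (cokernel.π (f ≫ g)))
      ((F i).map (cokernel.map (f ≫ g) g f (𝟙 _) _))
  have h₃ : Epi ((F i).mapShortComplex.map φ).τ₁ := hf i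
  have h₄ : Epi ((F i).mapShortComplex.map φ).τ₃ := by
    change Epi ((F i).map (𝟙 _))
    infer_instance
  exact ShortComplex.epi_τ₂_of_exact_of_epi ((F i).mapShortComplex.map φ) hS₂

/-- The exact structure on an abelian category given by the short exact sequences which are sent
to short exact sequences by all functors of a family of left exact functors. -/
def exactStructure (hP : ∀ S, P S ↔ S.ShortExact ∧ ∀ i, Epi ((F i).map S.g)) :
    QuillenExactStructure D where
  conflation := P
  closedUnderIso :=
    { of_iso := by
        intro S S' e h
        rw [hP] at h ⊢
        refine ⟨ShortComplex.shortExact_of_iso e h.1, fun i => ?_⟩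
        have := h.2 i
        have hfac : S'.g = e.inv.τ₂ ≫ S.g ≫ e.hom.τ₃ := by
          rw [← e.hom.comm₂₃, ← Category.assoc, ← ShortComplex.comp_τ₂]
          simp
        rw [hfac, Functor.map_comp, Functor.map_comp]
        infer_instance }
  isKernel S h := ⟨((hP S).1 h).1.fIsKernel⟩
  isCokernel S h := ⟨((hP S).1 h).1.gIsCokernel⟩
  id_admissibleMono A := by
    rw [admissibleMono_iff hP]
    exact ⟨inferInstance, fun i =>
      IsZero.epi ((F i).map_isZero (isZero_cokernel_of_epi (𝟙 A))) _⟩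
  id_admissibleEpi A := by
    rw [admissibleEpi_iff hP]
    exact ⟨inferInstance, fun i => inferInstance⟩
  comp_admissibleMono := admissibleMono_comp hP
  comp_admissibleEpi f g hf hg := by
    rw [admissibleEpi_iff hP] at hf hg ⊢
    obtain ⟨_, hf⟩ := hf
    obtain ⟨_, hg⟩ := hg
    refine ⟨epi_comp _ _, fun i => ?_⟩
    have := hf i
    have := hg i
    rw [Functor.map_comp]
    infer_instance
  pushout_admissibleMono i a hi := by
    rw [admissibleMono_iff hP] at hi
    obtain ⟨_, hi⟩ := hi
    have sq := IsPushout.of_hasPushout i a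
    refine ⟨_, _, _, sq, ?_⟩
    rw [admissibleMono_iff hP]
    refine ⟨inferInstanceAs (Mono (pushout.inr i a)), fun j => ?_⟩
    have := hi j
    have := isIso_cokernel_map_of_isPushout sq.flip
    have := isIso_cokernel_map_of_isPushout sq
    have hfac : pushout.inl i a ≫ cokernel.π (pushout.inr i a) =
        cokernel.π i ≫ cokernel.map _ _ _ _ sq.w := by simp
    have : Epi ((F j).map (pushout.inl i a) ≫ (F j).map (cokernel.π (pushout.inr i a))) := by
      rw [← Functor.map_comp, hfac, Functor.map_comp]
      infer_instance
    exact epi_of_epi ((F j).map (pushout.inl i a)) _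
  pullback_admissibleEpi p z hp := by
    rw [admissibleEpi_iff hP] at hp
    obtain ⟨_, hp⟩ := hp
    have sq := IsPullback.of_hasPullback p z
    refine ⟨_, _, _, sq, ?_⟩
    rw [admissibleEpi_iff hP]
    refine ⟨inferInstanceAs (Epi (pullback.snd p z)), fun j => ?_⟩
    have := hp j
    exact Abelian.epi_snd_of_isLimit _ _ (sq.map (F j)).isLimit

end ExactOfFunctors

/-! ### Acyclicity relative to a class of objects, balanced pairs -/

section Relative

variable {A : Type u} [Category.{v} A] [Abelian A]

/-- A complex `K` is right `X`-acyclic if `Hom(M, K)` is acyclic for all `M` in `X`. -/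
def IsRightAcyclic (X : ObjectProperty A) {ι : Type*} {c : ComplexShape ι}
    (K : HomologicalComplex A c) : Prop :=
  ∀ M : A, X M →
    (((preadditiveCoyoneda.obj (Opposite.op M)).mapHomologicalComplex c).obj K).Acyclic

/-- A complex `K` is left `Y`-acyclic if `Hom(K, N)` is acyclic for all `N` in `Y`. -/
def IsLeftAcyclic (Y : ObjectProperty A) {ι : Type*} {c : ComplexShape ι}
    (K : HomologicalComplex A c) : Prop :=
  ∀ N : A, Y N → (((preadditiveYoneda.obj N).mapHomologicalComplex c.symm).obj K.op).Acyclic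

/-- `f : M₀ ⟶ M` is a right `X`-approximation of `M`. -/
def IsRightApproximation (X : ObjectProperty A) {M₀ M : A} (f : M₀ ⟶ M) : Prop :=
  X M₀ ∧ ∀ (M' : A) (g : M' ⟶ M), X M' → ∃ h : M' ⟶ M₀, h ≫ f = g

/-- `f : M ⟶ M₀` is a left `Y`-approximation of `M`. -/
def IsLeftApproximation (Y : ObjectProperty A) {M M₀ : A} (f : M ⟶ M₀) : Prop :=
  Y M₀ ∧ ∀ (M' : A) (g : M ⟶ M'), Y M' → ∃ h : M₀ ⟶ M', f ≫ h = g

/-- `(X, Y)` is a balanced pair. A complex `⋯ → X₁ → X₀ → M → 0` is encoded as a chain complex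
indexed by `ℕ` with `M` in degree `0` and `Xₙ` in degree `n + 1`; dually for coresolutions. -/
structure IsBalancedPair (X Y : ObjectProperty A) : Prop where
  contravariantlyFinite : ∀ M : A, ∃ (M₀ : A) (f : M₀ ⟶ M), IsRightApproximation X f
  covariantlyFinite : ∀ M : A, ∃ (M₀ : A) (f : M ⟶ M₀), IsLeftApproximation Y f
  exists_resolution : ∀ M : A, ∃ K : ChainComplex A ℕ, Nonempty (K.X 0 ≅ M) ∧
    (∀ n, X (K.X (n + 1))) ∧ IsRightAcyclic X K ∧ IsLeftAcyclic Y K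
  exists_coresolution : ∀ N : A, ∃ K : CochainComplex A ℕ, Nonempty (K.X 0 ≅ N) ∧
    (∀ n, Y (K.X (n + 1))) ∧ IsRightAcyclic X K ∧ IsLeftAcyclic Y K

/-- A balanced pair `(X, Y)` is admissible if all right `X`-approximations are epimorphisms and
all left `Y`-approximations are monomorphisms. -/
structure IsAdmissibleBalancedPair (X Y : ObjectProperty A) : Prop
    extends IsBalancedPair X Y where
  epi_of_isRightApproximation : ∀ {M₀ M : A} (f : M₀ ⟶ M), IsRightApproximation X f → Epi f
  mono_of_isLeftApproximation : ∀ {M M₀ : A} (f : M ⟶ M₀), IsLeftApproximation Y f → Mono f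

/-! ### The exact categories `(A, 𝓔)` and `Ch(A, 𝓔)` -/

/-- The class `𝓔` of short exact sequences in `A` which remain short exact after applying
`Hom(M, -)` for all `M` in `X`. -/
def relativeShortExact (X : ObjectProperty A) : ObjectProperty (ShortComplex A) :=
  fun S => S.ShortExact ∧
    ∀ M : A, X M → (S.map (preadditiveCoyoneda.obj (Opposite.op M))).ShortExact

/-- The class `Ch(𝓔)` of short sequences of chain complexes which are in `𝓔` degreewise. -/
def chainRelativeShortExact (X : ObjectProperty A) :
    ObjectProperty (ShortComplex (ChainComplex A ℤ)) :=
  fun S => ∀ n : ℤ, relativeShortExact X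
    (S.map (HomologicalComplex.eval A (ComplexShape.down ℤ) n))

lemma relativeShortExact_iff (X : ObjectProperty A) (S : ShortComplex A) :
    relativeShortExact X S ↔ S.ShortExact ∧ ∀ M : {M : A // X M},
      Epi ((preadditiveCoyoneda.obj (Opposite.op M.1)).map S.g) := by
  constructor
  · rintro ⟨h, h'⟩
    exact ⟨h, fun M => (h' M.1 M.2).epi_g⟩
  · rintro ⟨h, h'⟩
    refine ⟨h, fun M hM => ?_⟩
    have := h.mono_f
    exact
      { exact := h.exact.map_of_mono_of_preservesKernel _ h.mono_f inferInstance
        mono_f := inferInstanceAs (Mono ((preadditiveCoyoneda.obj (Opposite.op M)).map S.f))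
        epi_g := h' ⟨M, hM⟩ }

lemma chainRelativeShortExact_iff (X : ObjectProperty A)
    (S : ShortComplex (ChainComplex A ℤ)) :
    chainRelativeShortExact X S ↔ S.ShortExact ∧ ∀ M : {M : A // X M} × ℤ,
      Epi ((HomologicalComplex.eval A (ComplexShape.down ℤ) M.2 ⋙
        preadditiveCoyoneda.obj (Opposite.op M.1.1)).map S.g) := by
  simp only [chainRelativeShortExact, relativeShortExact_iff,
    HomologicalComplex.shortExact_iff_degreewise_shortExact, forall_and, Prod.forall]
  exact and_congr_right fun _ => forall_comm

/-- The exact category `(A, 𝓔)`. -/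
noncomputable def relativeExactStructure (X : ObjectProperty A) : QuillenExactStructure A :=
  ExactOfFunctors.exactStructure (relativeShortExact_iff X)

/-- The exact category `Ch(A, 𝓔)` of chain complexes, whose short exact sequences are those
which are in `𝓔` degreewise. -/
noncomputable def chainExactStructure (X : ObjectProperty A) : QuillenExactStructure (ChainComplex A ℤ) :=
  ExactOfFunctors.exactStructure (chainRelativeShortExact_iff X)

/-! ### Classes of complexes -/

/-- The complexes all of whose terms are in `X`. -/
def degreewise (X : ObjectProperty A) : ObjectProperty (ChainComplex A ℤ) :=
  fun K => ∀ n : ℤ, X (K.X n)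

/-- The right `X`-acyclic complexes all of whose terms are in `X`. -/
def degreewiseAcyclic (X : ObjectProperty A) : ObjectProperty (ChainComplex A ℤ) :=
  fun K => degreewise X K ∧ IsRightAcyclic X K

end Relative

/-! A conflation of `Ch(A, 𝓔)` whose last complex has terms in `X` splits in each degree, because
the identity of each term lifts. Hence, for a class of complexes with terms in `X` that is closed
under shifts and degreewise split extensions, `Ext¹`-orthogonality is Hom-orthogonality in the
homotopy category K(A) (`rightOrthogonal_inverseImage_iff`). It remains to decompose K(A).

Write P * Q for the class of middle terms of triangles from P to Q, and D, R, F for the classes of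
complexes with terms in `X`, of right `X`-acyclic complexes, and of those in both. Two
decompositions hold. K(A) = D * D^⊥: the left side contains the stalk complexes by the
`X`-resolutions and is closed under countable sums, by the hypothesis on D^⊥. K(A) = R * R^⊥: the
stalks come from the `Y`-coresolutions, and both classes are closed under products. In each case P *
P^⊥ is triangulated, and truncations with telescopes reach every complex from the stalks
(`eq_top_of_coproducts`, `eq_top_of_products`). Balance enters in the second case: right `X`-acyclic
complexes are also exact under Hom(-, N) for N in `Y` (`relAcyclic.exists_desc`).

Decomposing an object of R by the first pair gives a piece in D^⊥. Such a piece lies in R, so the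
other piece lies in F, whence R ≤ F * F^⊥. Then K(A) = R * R^⊥ ≤ F * F^⊥ * R^⊥ ≤ F * F^⊥, since R^⊥
≤ F^⊥. These are the special preenvelopes (`exists_termwiseRelAcyclic_preenvelope`). Salce's pushout
argument, with contractible complexes covering every complex, gives special precovers. F is closed
under retracts, so F is the whole left orthogonal of F^⊥. -/

section Triangulated

/-! ### Extension products with a right orthogonal in a triangulated category. -/

open Pretriangulated

variable {C : Type u} [Category.{v} C] [HasZeroObject C] [HasShift C ℤ] [Preadditive C]
  [∀ n : ℤ, (shiftFunctor C n).Additive] [Pretriangulated C] (P : ObjectProperty C)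

/-- The connecting morphism goes from an object of `P` to a shift of an object of its orthogonal, so
it vanishes. The triangle splits and its two ends can be exchanged. -/
lemma rightOrthogonal_extensionProduct_le [P.IsStableUnderShift ℤ] :
    P.rightOrthogonal.extensionProduct P ≤ P.extensionProduct P.rightOrthogonal := by
  rintro M ⟨V, U, f, g, h, hT, hV, hU⟩
  have h0 : h = 0 := (P.rightOrthogonal.le_shift (1 : ℤ) V hV) h hU
  obtain ⟨e, -, -⟩ := exists_iso_binaryBiproduct_of_distTriang _ hT h0
  refine ObjectProperty.prop_of_iso _ ((biprod.braiding _ _) ≪≫ e.symm)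
    ⟨_, _, _, _, _, binaryBiproductTriangle_distinguished U V, hU, hV⟩

lemma extensionProduct_self_le [P.IsTriangulatedClosed₂] [P.IsClosedUnderIsomorphisms] :
    P.extensionProduct P ≤ P :=
  ObjectProperty.extensionProduct_le_of_isTriangulatedClosed₂ le_rfl le_rfl

/-- Writing Q for the orthogonal, closure under extensions is P * Q * P * Q ≤ P * P * Q * Q ≤ P * Q,
by exchanging the two middle factors. -/
instance [IsTriangulated C] [P.IsTriangulated] [P.IsClosedUnderIsomorphisms] :
    (P.extensionProduct P.rightOrthogonal).IsTriangulated where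
  exists_zero := ⟨_, isZero_zero C,
    P.le_extensionProduct_left P.rightOrthogonal _ (P.prop_zero)⟩
  toIsTriangulatedClosed₂ := .mk' (fun T hT h₁ h₃ => by
    have h := (ObjectProperty.extensionProduct_iff _ _ _).2 ⟨_, _, _, _, _, hT, h₁, h₃⟩
    have h' : (P.extensionProduct P.rightOrthogonal).extensionProduct
        (P.extensionProduct P.rightOrthogonal) ≤ P.extensionProduct P.rightOrthogonal := by
      rw [ObjectProperty.extensionProduct_assoc, ← ObjectProperty.extensionProduct_assoc
        P.rightOrthogonal]
      refine (ObjectProperty.monotone_extensionProduct_right _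
        (ObjectProperty.monotone_extensionProduct_left _
          (rightOrthogonal_extensionProduct_le P))).trans ?_
      rw [ObjectProperty.extensionProduct_assoc, ← ObjectProperty.extensionProduct_assoc P P]
      exact (ObjectProperty.monotone_extensionProduct_left _
        (extensionProduct_self_le P)).trans (ObjectProperty.monotone_extensionProduct_right _
          (extensionProduct_self_le _))
    exact h' _ h)

end Triangulated

/-! ### Splitting of telescope sequences that become stationary. -/

section Telescope

lemma exists_telescope_retraction {C : Type u} [Category.{v} C] [Preadditive C] (N : ℕ) :
    ∀ {M : ℕ → C} (s : ∀ i, M i ⟶ M (i + 1)), (∀ i, N ≤ i → IsIso (s i)) →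
      ∀ {T : C} (a : ∀ i, M i ⟶ T), ∃ r : ∀ i, M i ⟶ T, ∀ i, r i = a i + s i ≫ r (i + 1) := by
  induction N with
  | zero =>
    intro M s hs T a
    have (i : ℕ) : IsIso (s i) := hs i (Nat.zero_le i)
    -- With all `s i` invertible the equation is solved forwards from the arbitrary value `r 0 = 0`;
    -- in the successor case the missing first value is given by the equation itself.
    exact ⟨fun i => Nat.rec 0 (fun i r => inv (s i) ≫ (r - a i)) i, fun i => by simp⟩
  | succ N hN =>
    intro M s hs T a
    obtain ⟨r, hr⟩ := hN (fun i => s (i + 1)) (fun i hi => hs _ (by lia)) (fun i => a (i + 1))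
    refine ⟨fun i => match i with
      | 0 => a 0 + s 0 ≫ r 0
      | i + 1 => r i, fun i => ?_⟩
    match i with
    | 0 => rfl
    | i + 1 => exact hr i

variable {C : Type u} [Category.{v} C] [Preadditive C]

/-- For a sequence that is stationary from `N` on, the colimit is already `M N`, which supplies a
section. A retraction of "identity minus shift" is a solution of the recursion in
`exists_telescope_retraction`. No exactness of colimits is needed. -/
lemma telescope_splitting {M : ℕ → C} (s : ∀ i, M i ⟶ M (i + 1)) (S : ShortComplex C)
    (p : ∀ i, M i ⟶ S.X₃) (hp : ∀ i, s i ≫ p (i + 1) = p i)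
    (N : ℕ) (hN : ∀ i, N ≤ i → IsIso (p i))
    (ι₁ : ∀ i, M i ⟶ S.X₁) (h₁ : IsColimit (Cofan.mk _ ι₁))
    (ι₂ : ∀ i, M i ⟶ S.X₂) (h₂ : IsColimit (Cofan.mk _ ι₂))
    (hf : ∀ i, ι₁ i ≫ S.f = ι₂ i - s i ≫ ι₂ (i + 1))
    (hg : ∀ i, ι₂ i ≫ S.g = p i) : Nonempty S.Splitting := by
  have hs (i : ℕ) (hi : N ≤ i) : IsIso (s i) := by
    have := hN i hi
    have := hN (i + 1) (by lia)
    exact IsIso.of_isIso_fac_right (hp i)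
  obtain ⟨r, hr⟩ := exists_telescope_retraction N s hs ι₁
  have hpN := hN N le_rfl
  let r' : S.X₂ ⟶ S.X₁ := Cofan.IsColimit.desc h₂ r
  have hr' (i : ℕ) : ι₂ i ≫ r' = r i := Cofan.IsColimit.fac h₂ r i
  have hfr : S.f ≫ r' = 𝟙 _ := Cofan.IsColimit.hom_ext h₁ _ _ fun i => by
    dsimp
    rw [reassoc_of% (hf i), Preadditive.sub_comp, Category.assoc, hr', hr', hr i]
    simp
  let σ : S.X₃ ⟶ S.X₂ := inv (p N) ≫ ι₂ N
  -- This says that `S.g` is a cokernel of `S.f`, with descent through `σ`. A map killed by `S.f` is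
  -- compatible with the `s i`, hence determined by its component at `N`: above `N` the `s i` are
  -- cancelled, below `N` one composes with them.
  have hfac {T : C} (x : S.X₂ ⟶ T) (hx : S.f ≫ x = 0) : S.g ≫ σ ≫ x = x := by
    have hx' (i : ℕ) : ι₂ i ≫ x = s i ≫ ι₂ (i + 1) ≫ x := by
      have := ι₁ i ≫= hx
      rw [reassoc_of% (hf i)] at this
      simpa [sub_eq_zero] using this
    refine Cofan.IsColimit.hom_ext h₂ _ _ fun i => ?_
    have key : p i ≫ σ ≫ x = ι₂ i ≫ x := by
      have h1 : p N ≫ σ ≫ x = ι₂ N ≫ x := by simp [σ]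
      obtain hi | hi := le_total N i
      · induction i, hi using Nat.le_induction with
        | base => exact h1
        | succ i hi IH =>
          have := hs i hi
          rw [← cancel_epi (s i), ← hx', ← IH, reassoc_of% (hp i)]
      · induction hi using Nat.decreasingInduction with
        | self => exact h1
        | of_succ i hi IH => rw [hx', ← IH, reassoc_of% (hp i)]
    dsimp
    rw [reassoc_of% (hg i), key]
  have hσg : σ ≫ S.g = 𝟙 _ := by simp [σ, hg]
  have hgσ := hfac (𝟙 _ - r' ≫ S.f) (by simp [reassoc_of% hfr])
  exact ⟨{
    r := r'
    s := σ ≫ (𝟙 _ - r' ≫ S.f)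
    f_r := hfr
    s_g := by simp [hσg]
    id := by rw [hgσ]; simp }⟩

end Telescope

/-! ### Reaching all complexes from stalk complexes by truncations and countable coproducts. -/

section Density

/-- A class of cochain complexes satisfies two out of three
for degreewise split short exact sequences. -/
structure DegreewiseSplitTwoOutOfThree {C : Type u} [Category.{v} C] [Preadditive C]
    (T : ObjectProperty (CochainComplex C ℤ)) : Prop where
  prop_X₁ (S : ShortComplex (CochainComplex C ℤ))
    (σ : ∀ n, Nonempty (S.map (HomologicalComplex.eval C _ n)).Splitting) :
    T S.X₂ → T S.X₃ → T S.X₁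
  prop_X₂ (S : ShortComplex (CochainComplex C ℤ))
    (σ : ∀ n, Nonempty (S.map (HomologicalComplex.eval C _ n)).Splitting) :
    T S.X₁ → T S.X₃ → T S.X₂
  prop_X₃ (S : ShortComplex (CochainComplex C ℤ))
    (σ : ∀ n, Nonempty (S.map (HomologicalComplex.eval C _ n)).Splitting) :
    T S.X₁ → T S.X₂ → T S.X₃

variable {C : Type u} [Category.{v} C] [Abelian C]

namespace CochainComplex

/-- The subcomplex of `M` consisting of the terms in degrees `≥ p`. -/
noncomputable def brutalGE (M : CochainComplex C ℤ) (p : ℤ) : CochainComplex C ℤ where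
  X k := ∐ fun _ : PLift (p ≤ k) => M.X k
  d i j := Sigma.desc fun _ =>
    if h : p ≤ j then M.d i j ≫ Sigma.ι (fun _ : PLift (p ≤ j) => M.X j) ⟨h⟩ else 0
  shape i j hij := by ext; simp [M.shape i j hij]
  d_comp_d' i j k _ _ := by
    ext
    by_cases hj : p ≤ j <;> by_cases hk : p ≤ k <;> simp [hj, hk]

/-- The inclusion of `M.brutalGE p` in `M.brutalGE q` for `q ≤ p`. -/
noncomputable def brutalGEMap (M : CochainComplex C ℤ) {p q : ℤ} (h : q ≤ p) :
    M.brutalGE p ⟶ M.brutalGE q where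
  f k := Sigma.desc fun hk => Sigma.ι (fun _ : PLift (q ≤ k) => M.X k) ⟨h.trans hk.1⟩
  comm' i j hij := by
    refine Sigma.hom_ext _ _ fun ⟨hi⟩ => ?_
    have h₁ : p ≤ j := hi.trans (by simp at hij; lia)
    simp [brutalGE, h₁, h.trans h₁]

/-- The inclusion of `M.brutalGE p` in `M`. -/
noncomputable def brutalGEι (M : CochainComplex C ℤ) (p : ℤ) : M.brutalGE p ⟶ M where
  f k := Sigma.desc fun _ => 𝟙 _
  comm' i j hij := by
    refine Sigma.hom_ext _ _ fun ⟨hi⟩ => ?_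
    have h₁ : p ≤ j := hi.trans (by simp at hij; lia)
    simp [brutalGE, h₁]

@[simp]
lemma brutalGEMap_ι (M : CochainComplex C ℤ) {p q : ℤ} (h : q ≤ p) :
    M.brutalGEMap h ≫ M.brutalGEι q = M.brutalGEι p := by
  ext k
  dsimp [brutalGEMap, brutalGEι, brutalGE]
  ext
  simp

lemma isIso_brutalGEι_f (M : CochainComplex C ℤ) {p k : ℤ} (h : p ≤ k) :
    IsIso ((M.brutalGEι p).f k) := by
  refine ⟨Sigma.ι (fun _ : PLift (p ≤ k) => M.X k) ⟨h⟩, ?_, ?_⟩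
  · dsimp [brutalGEι, brutalGE]
    ext
    simp
  · exact Sigma.ι_desc _ _

lemma isZero_brutalGE_X (M : CochainComplex C ℤ) {p k : ℤ} (h : k < p) :
    IsZero ((M.brutalGE p).X k) := by
  rw [IsZero.iff_id_eq_zero]
  dsimp [brutalGE]
  ext ⟨hk⟩
  lia

instance (M : CochainComplex C ℤ) (p : ℤ) : (M.brutalGE p).IsStrictlyGE p := by
  rw [isStrictlyGE_iff]
  exact fun i hi => M.isZero_brutalGE_X hi

lemma isStrictlyLE_brutalGE (M : CochainComplex C ℤ) (p b : ℤ) [M.IsStrictlyLE b] :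
    (M.brutalGE p).IsStrictlyLE b := by
  rw [isStrictlyLE_iff]
  intro i hi
  by_cases h : p ≤ i
  · have := M.isIso_brutalGEι_f h
    exact (M.isZero_of_isStrictlyLE b i hi).of_iso (asIso ((M.brutalGEι p).f i))
  · exact M.isZero_brutalGE_X (by lia)

instance (M : CochainComplex C ℤ) (p : ℤ) : Mono (M.brutalGEι p) := by
  have (k : ℤ) : Mono ((M.brutalGEι p).f k) := by
    by_cases h : p ≤ k
    · have := M.isIso_brutalGEι_f h
      infer_instance
    · exact ⟨fun _ _ _ => (M.isZero_brutalGE_X (by lia)).eq_of_tgt _ _⟩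
  exact HomologicalComplex.mono_of_mono_f _ this

/-- The exact sequence `M.brutalGE p ⟶ M ⟶ coker`. -/
noncomputable def brutalShortComplex (M : CochainComplex C ℤ) (p : ℤ) :
    ShortComplex (CochainComplex C ℤ) :=
  ShortComplex.mk (M.brutalGEι p) (cokernel.π _) (cokernel.condition _)

lemma brutalShortComplex_shortExact (M : CochainComplex C ℤ) (p : ℤ) :
    (M.brutalShortComplex p).ShortExact where
  exact := ShortComplex.exact_cokernel _
  mono_f := inferInstanceAs (Mono (M.brutalGEι p))
  epi_g := inferInstanceAs (Epi (cokernel.π (M.brutalGEι p)))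

lemma isIso_brutalShortComplex_g_f (M : CochainComplex C ℤ) {p k : ℤ} (h : k < p) :
    IsIso ((M.brutalShortComplex p).g.f k) := by
  have hS := (HomologicalComplex.shortExact_iff_degreewise_shortExact _).1
    (M.brutalShortComplex_shortExact p) k
  exact hS.isIso_g_iff.2 (M.isZero_brutalGE_X h)

lemma isZero_brutalShortComplex_X₃ (M : CochainComplex C ℤ) {p k : ℤ} (h : p ≤ k) :
    IsZero ((M.brutalShortComplex p).X₃.X k) := by
  have hS := (HomologicalComplex.shortExact_iff_degreewise_shortExact _).1
    (M.brutalShortComplex_shortExact p) k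
  exact hS.isIso_f_iff.1 (M.isIso_brutalGEι_f h)

lemma brutalShortComplex_splitting (M : CochainComplex C ℤ) (p k : ℤ) :
    Nonempty ((M.brutalShortComplex p).map (HomologicalComplex.eval C _ k)).Splitting := by
  by_cases h : p ≤ k
  · exact ⟨.ofIsIsoOfIsZero _ (M.isIso_brutalGEι_f h) (M.isZero_brutalShortComplex_X₃ h)⟩
  · exact ⟨.ofIsZeroOfIsIso _ (M.isZero_brutalGE_X (by lia))
      (M.isIso_brutalShortComplex_g_f (by lia))⟩

/-- The transition map `M.truncLE n ⟶ M.truncLE m` for `n ≤ m`. -/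
lemma exists_truncLE_map (M : CochainComplex C ℤ) (n m : ℤ) (h : n ≤ m) :
    ∃ f : M.truncLE n ⟶ M.truncLE m, f ≫ M.ιTruncLE m = M.ιTruncLE n := by
  have := (M.truncLE n).isStrictlyLE_of_le n m h
  refine ⟨inv ((M.truncLE n).ιTruncLE m) ≫ truncLEMap (M.ιTruncLE n) m, ?_⟩
  simp

lemma isIso_πTruncGE_f {ι ι' : Type*} {c : ComplexShape ι} {c' : ComplexShape ι'}
    {D : Type*} [Category* D] [HasZeroMorphisms D] [HasZeroObject D]
    (K : HomologicalComplex D c') (e : c.Embedding c') [e.IsTruncGE]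
    [∀ i, K.HasHomology i] {i : ι} {i' : ι'} (hi : e.f i = i') (hi' : ¬ e.BoundaryGE i) :
    IsIso ((K.πTruncGE e).f i') := by
  exact (e.isIso_liftExtend_f_iff (K.restrictionToTruncGE' e)
    (K.restrictionToTruncGE'_hasLift e) hi).2 (K.isIso_restrictionToTruncGE' e i hi')

/-- The canonical truncation keeps the terms below `n`; in degree `n`, the boundary of the
embedding, it takes cycles, hence the strict inequality. -/
lemma isIso_ιTruncLE_f (M : CochainComplex C ℤ) {n i : ℤ} (hi : i < n) :
    IsIso ((M.ιTruncLE n).f i) := by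
  have := isIso_πTruncGE_f M.op (ComplexShape.embeddingUpIntLE n).op (i := (n - i).natAbs)
    (i' := i) (by
      change n - ((n - i).natAbs : ℤ) = i
      lia) (fun h => by
      rw [ComplexShape.Embedding.op_boundaryGE_iff,
        ComplexShape.boundaryLE_embeddingUpIntLE_iff, Int.natAbs_eq_zero] at h
      lia)
  exact inferInstanceAs
    (IsIso ((M.op.πTruncGE (ComplexShape.embeddingUpIntLE n).op).f i).unop)

end CochainComplex

namespace DegreewiseSplitTwoOutOfThree

variable {T : ObjectProperty (CochainComplex C ℤ)} (hT : DegreewiseSplitTwoOutOfThree T)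

include hT

/-- Induction on the amplitude: the brutal truncation in degrees `≥ a + 1` is shorter, and the
quotient is the stalk in degree `a`. -/
lemma of_bounded
    (h₀ : ∀ (M : CochainComplex C ℤ) (n : ℤ), M.IsStrictlyGE n → M.IsStrictlyLE n → T M)
    (n : ℕ) (M : CochainComplex C ℤ) (a : ℤ) (_ : M.IsStrictlyGE a) (_ : M.IsStrictlyLE (a + n)) :
    T M := by
  induction n generalizing M a with
  | zero => exact h₀ M a inferInstance (by simpa using ‹M.IsStrictlyLE (a + (0 : ℕ))›)
  | succ n hn =>
    refine hT.prop_X₂ (M.brutalShortComplex (a + 1)) (M.brutalShortComplex_splitting _) ?_ ?_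
    · exact hn _ (a + 1) (inferInstanceAs ((M.brutalGE (a + 1)).IsStrictlyGE (a + 1)))
        (by
          have : M.IsStrictlyLE (a + 1 + n) := by
            convert ‹M.IsStrictlyLE _› using 1
            push_cast; ring
          exact M.isStrictlyLE_brutalGE (a + 1) (a + 1 + n))
    · refine h₀ _ a ?_ ?_
      · rw [CochainComplex.isStrictlyGE_iff]
        intro i hi
        have := M.isIso_brutalShortComplex_g_f (p := a + 1) (k := i) (by lia)
        exact (M.isZero_of_isStrictlyGE a i hi).of_iso
          (asIso ((M.brutalShortComplex (a + 1)).g.f i)).symm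
      · rw [CochainComplex.isStrictlyLE_iff]
        exact fun i hi => M.isZero_brutalShortComplex_X₃ (by lia)

/-- `L` is the third term of the telescope sequence on `∐ M`. Since only degreewise splittings are
required, the stage `N` of stabilisation may depend on the degree. -/
lemma of_telescope [HasColimitsOfShape (Discrete ℕ) C]
    (h : ∀ M : ℕ → CochainComplex C ℤ, (∀ i, T (M i)) → T (∐ M))
    {M : ℕ → CochainComplex C ℤ} (hM : ∀ i, T (M i)) (s : ∀ i, M i ⟶ M (i + 1))
    {L : CochainComplex C ℤ} (p : ∀ i, M i ⟶ L) (hp : ∀ i, s i ≫ p (i + 1) = p i)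
    (hN : ∀ n, ∃ N, ∀ i, N ≤ i → IsIso ((p i).f n)) : T L := by
  let S : ShortComplex (CochainComplex C ℤ) :=
    ShortComplex.mk (X₁ := ∐ M) (X₂ := ∐ M)
      (Sigma.desc fun i => Sigma.ι M i - s i ≫ Sigma.ι M (i + 1)) (Sigma.desc p)
      (by ext1 i; simp [hp])
  refine hT.prop_X₃ S (fun n => ?_) (h M hM) (h M hM)
  obtain ⟨N, hN⟩ := hN n
  have hc : IsColimit (Cofan.mk ((∐ M).X n) fun i => (Sigma.ι M i).f n) :=
    isColimitCofanMkObjOfIsColimit (HomologicalComplex.eval C _ n) _ _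
      (coproductIsCoproduct M)
  refine telescope_splitting (fun i => (s i).f n) _ (fun i => (p i).f n)
    (fun i => congr_arg (fun φ => φ.f n) (hp i)) N hN _ hc _ hc (fun i => ?_) (fun i => ?_)
  · have : Sigma.ι M i ≫ S.f = Sigma.ι M i - s i ≫ Sigma.ι M (i + 1) := by simp [S]
    exact congr_arg (fun φ => φ.f n) this
  · have : Sigma.ι M i ≫ S.g = p i := by simp [S]
    exact congr_arg (fun φ => φ.f n) this

/-- A class of complexes which contains the complexes concentrated in one degree, which satisfies
two out of three for degreewise split short exact sequences and is closed under countable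
coproducts contains all complexes. -/
lemma eq_top_of_coproducts [HasColimitsOfShape (Discrete ℕ) C]
    (h₀ : ∀ (M : CochainComplex C ℤ) (n : ℤ), M.IsStrictlyGE n → M.IsStrictlyLE n → T M)
    (h : ∀ M : ℕ → CochainComplex C ℤ, (∀ i, T (M i)) → T (∐ M))
    (M : CochainComplex C ℤ) : T M := by
  -- A complex bounded above is the union of its bounded brutal subcomplexes in degrees `≥ b - i`.
  have hLE (M : CochainComplex C ℤ) (b : ℤ) [M.IsStrictlyLE b] : T M := by
    refine hT.of_telescope h (M := fun i => M.brutalGE (b - i))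
      (fun i => hT.of_bounded h₀ i _ (b - i) inferInstance
        (by simpa using M.isStrictlyLE_brutalGE (b - i) b))
      (fun i => M.brutalGEMap (by lia)) (fun i => M.brutalGEι _) (by simp)
      (fun n => ⟨(b - n).toNat, fun i hi => M.isIso_brutalGEι_f (by lia)⟩)
  -- A general complex is exhausted by its canonical truncations. Brutal truncation from above would
  -- give quotients instead of subcomplexes.
  choose s hs using fun i : ℕ => M.exists_truncLE_map i (i + 1 : ℕ) (by lia)
  exact hT.of_telescope h (fun i => hLE _ (i : ℤ)) s _ hs
    (fun n => ⟨(n + 1).toNat, fun i hi => M.isIso_ιTruncLE_f (by lia)⟩)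

end DegreewiseSplitTwoOutOfThree

end Density

/-! ### The dual statement, for countable products. -/

section Density

variable {C : Type u} [Category.{v} C] [Abelian C]

open Opposite

namespace DegreewiseSplitTwoOutOfThree

variable {T : ObjectProperty (CochainComplex C ℤ)} (hT : DegreewiseSplitTwoOutOfThree T)

include hT

/-- Degreewise split sequences are self-dual; duality exchanges the outer terms and reverses the
sign of degrees. -/
lemma op : DegreewiseSplitTwoOutOfThree
    (fun K => T ((CochainComplex.opEquivalence C).inverse.obj K).unop) := by
  have key (S : ShortComplex (CochainComplex Cᵒᵖ ℤ))
      (σ : ∀ n, Nonempty (S.map (HomologicalComplex.eval Cᵒᵖ _ n)).Splitting) (n : ℤ) :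
      Nonempty ((ShortComplex.mk ((CochainComplex.opEquivalence C).inverse.map S.g).unop
        ((CochainComplex.opEquivalence C).inverse.map S.f).unop
        (by rw [← unop_comp, ← Functor.map_comp, S.zero]; rfl)).map
          (HomologicalComplex.eval C _ n)).Splitting :=
    ⟨(σ (-n)).some.unop⟩
  exact
    { prop_X₁ S σ h₂ h₃ := hT.prop_X₃ _ (key S σ) h₃ h₂
      prop_X₂ S σ h₁ h₃ := hT.prop_X₂ _ (key S σ) h₃ h₁
      prop_X₃ S σ h₁ h₂ := hT.prop_X₁ _ (key S σ) h₂ h₁ }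

/-- A class of complexes which contains the complexes concentrated in one degree, which satisfies
two out of three for degreewise split short exact sequences and is closed under countable
products contains all complexes. -/
lemma eq_top_of_products [HasLimitsOfShape (Discrete ℕ) C] [T.IsClosedUnderIsomorphisms]
    (h₀ : ∀ (M : CochainComplex C ℤ) (n : ℤ), M.IsStrictlyGE n → M.IsStrictlyLE n → T M)
    (h : ∀ M : ℕ → CochainComplex C ℤ, (∀ i, T (M i)) → T (∏ᶜ M))
    (M : CochainComplex C ℤ) : T M := by
  have : HasColimitsOfShape (Discrete ℕ) Cᵒᵖ := inferInstance
  refine T.prop_of_iso ((CochainComplex.opEquivalence C).unitIso.app (.op M)).unop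
    (hT.op.eq_top_of_coproducts (fun K n _ _ => h₀ _ (-n) ?_ ?_) (fun K hK => ?_) _)
  · rw [CochainComplex.isStrictlyGE_iff]
    exact fun i hi => (K.isZero_of_isStrictlyLE n (-i) (by lia)).unop
  · rw [CochainComplex.isStrictlyLE_iff]
    exact fun i hi => (K.isZero_of_isStrictlyGE n (-i) (by lia)).unop
  · let N (i : ℕ) := ((CochainComplex.opEquivalence C).inverse.obj (K i)).unop
    let e : (CochainComplex.opEquivalence C).inverse.obj (∐ K) ≅ Opposite.op (∏ᶜ N) :=
      PreservesCoproduct.iso (CochainComplex.opEquivalence C).inverse K ≪≫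
        (opProductIsoCoproduct N).symm
    exact T.prop_of_iso e.unop (h N hK)

end DegreewiseSplitTwoOutOfThree

end Density

/-! ### Classes of complexes in the homotopy category and their decompositions. -/

section HomotopyClasses

open Pretriangulated

variable {C : Type u} [Category.{v} C] [Abelian C]

/-- A class of cochain complexes contains zero, and is closed under shifts and degreewise split
extensions. -/
structure IsDegreewiseSplitThick (P : ObjectProperty (CochainComplex C ℤ)) : Prop where
  zero : ∃ Z, IsZero Z ∧ P Z
  shift (K : CochainComplex C ℤ) (n : ℤ) : P K → P (K⟦n⟧)
  ext (S : ShortComplex (CochainComplex C ℤ))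
    (σ : ∀ n, Nonempty (S.map (HomologicalComplex.eval C _ n)).Splitting) :
    P S.X₁ → P S.X₃ → P S.X₂

/-- The class of objects of the homotopy category which are homotopy equivalent to
complexes in `P`. -/
abbrev homotopyClass (P : ObjectProperty (CochainComplex C ℤ)) :
    ObjectProperty (HomotopyCategory C (.up ℤ)) :=
  P.map (HomotopyCategory.quotient C (.up ℤ))

lemma degreewiseSplitTwoOutOfThree (T : ObjectProperty (HomotopyCategory C (.up ℤ)))
    [T.IsTriangulated] [T.IsClosedUnderIsomorphisms] :
    DegreewiseSplitTwoOutOfThree (T.inverseImage (HomotopyCategory.quotient C (.up ℤ))) := by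
  have hS (S : ShortComplex (CochainComplex C ℤ))
      (σ : ∀ n, Nonempty (S.map (HomologicalComplex.eval C _ n)).Splitting) :
      CochainComplex.trianglehOfDegreewiseSplit S (fun n => (σ n).some) ∈
        distTriang (HomotopyCategory C (.up ℤ)) :=
    (HomotopyCategory.distinguished_iff_iso_trianglehOfDegreewiseSplit _).2
      ⟨S, _, ⟨Iso.refl _⟩⟩
  exact
    { prop_X₁ S σ h₂ h₃ := T.ext_of_isTriangulatedClosed₁ _ (hS S σ) h₂ h₃
      prop_X₂ S σ h₁ h₃ := T.ext_of_isTriangulatedClosed₂ _ (hS S σ) h₁ h₃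
      prop_X₃ S σ h₁ h₂ := T.ext_of_isTriangulatedClosed₃ _ (hS S σ) h₁ h₂ }

namespace IsDegreewiseSplitThick

variable {P : ObjectProperty (CochainComplex C ℤ)} (hP : IsDegreewiseSplitThick P)

include hP

lemma mappingCone {K L : CochainComplex C ℤ} (φ : K ⟶ L) (hK : P K) (hL : P L) :
    P (CochainComplex.mappingCone φ) :=
  hP.ext (CochainComplex.mappingCone.triangleRotateShortComplex φ)
    (fun n => ⟨CochainComplex.mappingCone.triangleRotateShortComplexSplitting φ n⟩)
    hL (hP.shift _ 1 hK)

lemma isTriangulated : (homotopyClass P).IsTriangulated := by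
  have hshift : (homotopyClass P).IsStableUnderShift ℤ :=
    { isStableUnderShiftBy n :=
      { le_shift := by
          rintro _ ⟨K, hK, ⟨e⟩⟩
          exact ⟨_, hP.shift K n hK,
            ⟨((HomotopyCategory.quotient C (.up ℤ)).commShiftIso n).app K ≪≫
            (shiftFunctor _ n).mapIso e⟩⟩ } }
  have h₃ : (homotopyClass P).IsTriangulatedClosed₃ := .mk' (by
    rintro T hT ⟨K, hK, ⟨e⟩⟩ ⟨L, hL, ⟨e'⟩⟩
    obtain ⟨φ, hφ⟩ := (HomotopyCategory.quotient C (.up ℤ)).map_surjective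
      (e.hom ≫ T.mor₁ ≫ e'.inv)
    refine ⟨_, hP.mappingCone φ hK hL, ⟨Triangle.π₃.mapIso (isoTriangleOfIso₁₂ _ _
      (HomotopyCategory.mappingCone_triangleh_distinguished φ) hT e e' ?_)⟩⟩
    change (HomotopyCategory.quotient C (.up ℤ)).map φ ≫ e'.hom = e.hom ≫ T.mor₁
    simp [hφ])
  have h₂ : (homotopyClass P).IsTriangulatedClosed₂ := .of_isTriangulatedClosed₃
  exact
    { exists_zero := by
        obtain ⟨Z, hZ, h⟩ := hP.zero
        exact ⟨_, (HomotopyCategory.quotient C (.up ℤ)).map_isZero hZ, P.prop_map_obj _ h⟩ }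

end IsDegreewiseSplitThick

lemma rightOrthogonal_homotopyClass_iff (P : ObjectProperty (CochainComplex C ℤ))
    (K : CochainComplex C ℤ) :
    (homotopyClass P).rightOrthogonal ((HomotopyCategory.quotient C (.up ℤ)).obj K) ↔
      ∀ (L : CochainComplex C ℤ) (f : L ⟶ K), P L → Nonempty (Homotopy f 0) := by
  constructor
  · intro h L f hL
    exact ⟨HomotopyCategory.homotopyOfEq _ _ (by
      rw [h ((HomotopyCategory.quotient C (.up ℤ)).map f) (P.prop_map_obj _ hL),
        Functor.map_zero])⟩
  · rintro h _ f ⟨L, hL, ⟨e⟩⟩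
    obtain ⟨g, hg⟩ := (HomotopyCategory.quotient C (.up ℤ)).map_surjective (e.hom ≫ f)
    obtain ⟨H⟩ := h L g hL
    rw [← cancel_epi e.hom, ← hg, HomotopyCategory.eq_of_homotopy _ _ H]
    simp

/-- A triangle U → M → V has the strict model M → cone → U[1], which is degreewise split. Sums and
products of such decompositions can then be formed at the level of complexes. -/
lemma extensionProduct_rightOrthogonal_iff {P : ObjectProperty (CochainComplex C ℤ)}
    (hP : IsDegreewiseSplitThick P) (M : CochainComplex C ℤ) :
    (homotopyClass P).extensionProduct (homotopyClass P).rightOrthogonal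
      ((HomotopyCategory.quotient C (.up ℤ)).obj M) ↔
    ∃ (V U : CochainComplex C ℤ) (f : M ⟶ V) (g : V ⟶ U) (zero : f ≫ g = 0),
      (∀ n, Nonempty ((ShortComplex.mk f g zero).map
        (HomologicalComplex.eval C _ n)).Splitting) ∧
      (homotopyClass P).rightOrthogonal ((HomotopyCategory.quotient C (.up ℤ)).obj V) ∧ P U := by
  have := hP.isTriangulated
  constructor
  · rintro ⟨_, V, f, g, h, hT, ⟨U, hU, ⟨e⟩⟩, hV⟩
    obtain ⟨φ, hφ⟩ := (HomotopyCategory.quotient C (.up ℤ)).map_surjective (e.hom ≫ f)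
    refine ⟨CochainComplex.mappingCone φ, U⟦(1 : ℤ)⟧, _, _,
      (CochainComplex.mappingCone.triangleRotateShortComplex φ).zero,
      fun n => ⟨CochainComplex.mappingCone.triangleRotateShortComplexSplitting φ n⟩, ?_,
      hP.shift _ _ hU⟩
    refine ObjectProperty.prop_of_iso _ (Triangle.π₃.mapIso (isoTriangleOfIso₁₂ _ _
      (HomotopyCategory.mappingCone_triangleh_distinguished φ) hT e (Iso.refl _) ?_)).symm hV
    change (HomotopyCategory.quotient C (.up ℤ)).map φ ≫ 𝟙 _ = e.hom ≫ f
    simp [hφ]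
  · rintro ⟨V, U, f, g, zero, σ, hV, hU⟩
    have hT : CochainComplex.trianglehOfDegreewiseSplit _ (fun n => (σ n).some) ∈
        distTriang (HomotopyCategory C (.up ℤ)) :=
      (HomotopyCategory.distinguished_iff_iso_trianglehOfDegreewiseSplit _).2
        ⟨_, _, ⟨Iso.refl _⟩⟩
    exact ⟨_, _, _, _, _, inv_rot_of_distTriang _ hT,
      (homotopyClass P).le_shift (-1) _ (P.prop_map_obj _ hU), hV⟩

section

variable {ι : Type*}

lemma coproduct_splitting [HasColimitsOfShape (Discrete ι) C] {M V U : ι → CochainComplex C ℤ}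
    (f : ∀ i, M i ⟶ V i) (g : ∀ i, V i ⟶ U i) (zero : ∀ i, f i ≫ g i = 0)
    (σ : ∀ i n, Nonempty ((ShortComplex.mk (f i) (g i) (zero i)).map
      (HomologicalComplex.eval C _ n)).Splitting) :
    ∃ zero' : Limits.Sigma.map f ≫ Limits.Sigma.map g = 0, ∀ n,
      Nonempty ((ShortComplex.mk _ _ zero').map
        (HomologicalComplex.eval C _ n)).Splitting := by
  have zero' : Limits.Sigma.map f ≫ Limits.Sigma.map g = 0 := by
    ext1 i
    simp [reassoc_of% (zero i)]
  refine ⟨zero', fun n => ?_⟩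
  obtain ⟨ρ, τ, h₁, h₂, h₃⟩ : ∃ (ρ : ∀ i, (V i).X n ⟶ (M i).X n)
      (τ : ∀ i, (U i).X n ⟶ (V i).X n), (∀ i, (f i).f n ≫ ρ i = 𝟙 _) ∧
        (∀ i, τ i ≫ (g i).f n = 𝟙 _) ∧ (∀ i, ρ i ≫ (f i).f n + (g i).f n ≫ τ i = 𝟙 _) :=
    ⟨fun i => (σ i n).some.r, fun i => (σ i n).some.s, fun i => (σ i n).some.f_r,
      fun i => (σ i n).some.s_g, fun i => (σ i n).some.id⟩
  have hc (K : ι → CochainComplex C ℤ) :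
      IsColimit (Cofan.mk ((∐ K).X n) fun i => (Sigma.ι K i).f n) :=
    isColimitCofanMkObjOfIsColimit (HomologicalComplex.eval C _ n) _ _ (coproductIsCoproduct K)
  have hext {K : ι → CochainComplex C ℤ} {T : C} {x y : (∐ K).X n ⟶ T}
      (h : ∀ i, (Sigma.ι K i).f n ≫ x = (Sigma.ι K i).f n ≫ y) : x = y :=
    Cofan.IsColimit.hom_ext (hc K) _ _ h
  let r : (∐ V).X n ⟶ (∐ M).X n :=
    Cofan.IsColimit.desc (hc V) fun i => ρ i ≫ (Sigma.ι M i).f n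
  let s : (∐ U).X n ⟶ (∐ V).X n :=
    Cofan.IsColimit.desc (hc U) fun i => τ i ≫ (Sigma.ι V i).f n
  have hr (i : ι) : (Sigma.ι V i).f n ≫ r = ρ i ≫ (Sigma.ι M i).f n :=
    Cofan.IsColimit.fac (hc V) _ i
  have hs (i : ι) : (Sigma.ι U i).f n ≫ s = τ i ≫ (Sigma.ι V i).f n :=
    Cofan.IsColimit.fac (hc U) _ i
  have hf (i : ι) : (Sigma.ι M i).f n ≫ (Limits.Sigma.map f).f n =
      (f i).f n ≫ (Sigma.ι V i).f n := by
    rw [← HomologicalComplex.comp_f, ← HomologicalComplex.comp_f, Limits.Sigma.ι_map]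
  have hg (i : ι) : (Sigma.ι V i).f n ≫ (Limits.Sigma.map g).f n =
      (g i).f n ≫ (Sigma.ι U i).f n := by
    rw [← HomologicalComplex.comp_f, ← HomologicalComplex.comp_f, Limits.Sigma.ι_map]
  have hfr : (Limits.Sigma.map f).f n ≫ r = 𝟙 _ := hext fun i => by
    rw [reassoc_of% (hf i), hr, reassoc_of% (h₁ i), Category.comp_id]
  have hsg : s ≫ (Limits.Sigma.map g).f n = 𝟙 _ := hext fun i => by
    rw [reassoc_of% (hs i), hg, reassoc_of% (h₂ i), Category.comp_id]
  have hid : r ≫ (Limits.Sigma.map f).f n + (Limits.Sigma.map g).f n ≫ s = 𝟙 _ :=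
    hext fun i => by
      rw [Preadditive.comp_add, reassoc_of% (hr i), hf, reassoc_of% (hg i), hs,
        ← Category.assoc, ← Category.assoc, ← Preadditive.add_comp, h₃, Category.comp_id,
        Category.id_comp]
  exact ⟨{ r := r, s := s, f_r := hfr, s_g := hsg, id := hid }⟩

lemma product_splitting [HasLimitsOfShape (Discrete ι) C] {M V U : ι → CochainComplex C ℤ}
    (f : ∀ i, M i ⟶ V i) (g : ∀ i, V i ⟶ U i) (zero : ∀ i, f i ≫ g i = 0)
    (σ : ∀ i n, Nonempty ((ShortComplex.mk (f i) (g i) (zero i)).map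
      (HomologicalComplex.eval C _ n)).Splitting) :
    ∃ zero' : Limits.Pi.map f ≫ Limits.Pi.map g = 0, ∀ n,
      Nonempty ((ShortComplex.mk _ _ zero').map
        (HomologicalComplex.eval C _ n)).Splitting := by
  have zero' : Limits.Pi.map f ≫ Limits.Pi.map g = 0 := by
    ext1 i
    simp [zero i]
  refine ⟨zero', fun n => ?_⟩
  obtain ⟨ρ, τ, h₁, h₂, h₃⟩ : ∃ (ρ : ∀ i, (V i).X n ⟶ (M i).X n)
      (τ : ∀ i, (U i).X n ⟶ (V i).X n), (∀ i, (f i).f n ≫ ρ i = 𝟙 _) ∧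
        (∀ i, τ i ≫ (g i).f n = 𝟙 _) ∧ (∀ i, ρ i ≫ (f i).f n + (g i).f n ≫ τ i = 𝟙 _) :=
    ⟨fun i => (σ i n).some.r, fun i => (σ i n).some.s, fun i => (σ i n).some.f_r,
      fun i => (σ i n).some.s_g, fun i => (σ i n).some.id⟩
  have hc (K : ι → CochainComplex C ℤ) :
      IsLimit (Fan.mk ((∏ᶜ K).X n) fun i => (Pi.π K i).f n) :=
    isLimitFanMkObjOfIsLimit (HomologicalComplex.eval C _ n) _ _ (productIsProduct K)
  have hext {K : ι → CochainComplex C ℤ} {T : C} {x y : T ⟶ (∏ᶜ K).X n}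
      (h : ∀ i, x ≫ (Pi.π K i).f n = y ≫ (Pi.π K i).f n) : x = y :=
    Fan.IsLimit.hom_ext (hc K) _ _ h
  let r : (∏ᶜ V).X n ⟶ (∏ᶜ M).X n :=
    Fan.IsLimit.lift (hc M) fun i => (Pi.π V i).f n ≫ ρ i
  let s : (∏ᶜ U).X n ⟶ (∏ᶜ V).X n :=
    Fan.IsLimit.lift (hc V) fun i => (Pi.π U i).f n ≫ τ i
  have hr (i : ι) : r ≫ (Pi.π M i).f n = (Pi.π V i).f n ≫ ρ i :=
    Fan.IsLimit.fac (hc M) _ i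
  have hs (i : ι) : s ≫ (Pi.π V i).f n = (Pi.π U i).f n ≫ τ i :=
    Fan.IsLimit.fac (hc V) _ i
  have hf (i : ι) : (Limits.Pi.map f).f n ≫ (Pi.π V i).f n =
      (Pi.π M i).f n ≫ (f i).f n := by
    rw [← HomologicalComplex.comp_f, ← HomologicalComplex.comp_f, Limits.Pi.map_π]
  have hg (i : ι) : (Limits.Pi.map g).f n ≫ (Pi.π U i).f n =
      (Pi.π V i).f n ≫ (g i).f n := by
    rw [← HomologicalComplex.comp_f, ← HomologicalComplex.comp_f, Limits.Pi.map_π]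
  have hfr : (Limits.Pi.map f).f n ≫ r = 𝟙 _ := hext fun i => by
    rw [Category.assoc, hr, reassoc_of% (hf i), h₁, Category.comp_id, Category.id_comp]
  have hsg : s ≫ (Limits.Pi.map g).f n = 𝟙 _ := hext fun i => by
    rw [Category.assoc, hg, reassoc_of% (hs i), h₂, Category.comp_id, Category.id_comp]
  have hid : r ≫ (Limits.Pi.map f).f n + (Limits.Pi.map g).f n ≫ s = 𝟙 _ :=
    hext fun i => by
      rw [Preadditive.add_comp, Category.assoc, Category.assoc, hf, reassoc_of% (hr i), hs,
        reassoc_of% (hg i), ← Preadditive.comp_add, h₃, Category.comp_id, Category.id_comp]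
  exact ⟨{ r := r, s := s, f_r := hfr, s_g := hsg, id := hid }⟩

end

/-- If `P` and its right orthogonal in the homotopy category are closed under countable coproducts
and the homotopy category is generated accordingly by stalk complexes, then every complex `M` fits
in a degreewise split exact sequence `M ⟶ V ⟶ U` with `U` in `P` and `V` right orthogonal. -/
lemma exists_orthogonal_preenvelope_of_coproducts [HasColimitsOfShape (Discrete ℕ) C]
    {P : ObjectProperty (CochainComplex C ℤ)} (hP : IsDegreewiseSplitThick P)
    (hU : ∀ U : ℕ → CochainComplex C ℤ, (∀ i, P (U i)) → P (∐ U))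
    (hV : ∀ V : ℕ → CochainComplex C ℤ,
      (∀ i, (homotopyClass P).rightOrthogonal ((HomotopyCategory.quotient C (.up ℤ)).obj (V i))) →
        (homotopyClass P).rightOrthogonal ((HomotopyCategory.quotient C (.up ℤ)).obj (∐ V)))
    (h₀ : ∀ (M : CochainComplex C ℤ) (n : ℤ), M.IsStrictlyGE n → M.IsStrictlyLE n →
      (homotopyClass P).extensionProduct (homotopyClass P).rightOrthogonal
        ((HomotopyCategory.quotient C (.up ℤ)).obj M)) (M : CochainComplex C ℤ) :
    (homotopyClass P).extensionProduct (homotopyClass P).rightOrthogonal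
      ((HomotopyCategory.quotient C (.up ℤ)).obj M) := by
  have := hP.isTriangulated
  refine (degreewiseSplitTwoOutOfThree ((homotopyClass P).extensionProduct
    (homotopyClass P).rightOrthogonal)).eq_top_of_coproducts h₀ (fun M hM => ?_) M
  choose V U f g zero σ hVi hUi using
    fun i => (extensionProduct_rightOrthogonal_iff hP (M i)).1 (hM i)
  obtain ⟨zero', σ'⟩ := coproduct_splitting f g zero σ
  exact (extensionProduct_rightOrthogonal_iff hP _).2 ⟨_, _, _, _, zero', σ', hV V hVi, hU U hUi⟩

lemma exists_orthogonal_preenvelope_of_products [HasLimitsOfShape (Discrete ℕ) C]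
    {P : ObjectProperty (CochainComplex C ℤ)} (hP : IsDegreewiseSplitThick P)
    (hU : ∀ U : ℕ → CochainComplex C ℤ, (∀ i, P (U i)) → P (∏ᶜ U))
    (h₀ : ∀ (M : CochainComplex C ℤ) (n : ℤ), M.IsStrictlyGE n → M.IsStrictlyLE n →
      (homotopyClass P).extensionProduct (homotopyClass P).rightOrthogonal
        ((HomotopyCategory.quotient C (.up ℤ)).obj M)) (M : CochainComplex C ℤ) :
    (homotopyClass P).extensionProduct (homotopyClass P).rightOrthogonal
      ((HomotopyCategory.quotient C (.up ℤ)).obj M) := by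
  have := hP.isTriangulated
  refine (degreewiseSplitTwoOutOfThree ((homotopyClass P).extensionProduct
    (homotopyClass P).rightOrthogonal)).eq_top_of_products h₀ (fun M hM => ?_) M
  choose V U f g zero σ hVi hUi using
    fun i => (extensionProduct_rightOrthogonal_iff hP (M i)).1 (hM i)
  obtain ⟨zero', σ'⟩ := product_splitting f g zero σ
  refine (extensionProduct_rightOrthogonal_iff hP _).2 ⟨_, _, _, _, zero', σ', ?_, hU U hUi⟩
  -- An orthogonal class is always closed under products: the nullhomotopies of the components
  -- assemble into one for the product.
  simp only [rightOrthogonal_homotopyClass_iff] at hVi ⊢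
  intro L φ hL
  have H (i : ℕ) := (hVi i L (φ ≫ Pi.π V i) hL).some
  have hc (n : ℤ) : IsLimit (Fan.mk ((∏ᶜ V).X n) fun i => (Pi.π V i).f n) :=
    isLimitFanMkObjOfIsLimit (HomologicalComplex.eval C _ n) _ _ (productIsProduct V)
  let h (p q : ℤ) : L.X p ⟶ (∏ᶜ V).X q := Fan.IsLimit.lift (hc q) fun i => (H i).hom p q
  have hh (p q : ℤ) (i : ℕ) : h p q ≫ (Pi.π V i).f q = (H i).hom p q :=
    Fan.IsLimit.fac (hc q) _ i
  exact ⟨{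
    hom := h
    zero p q hpq := Fan.IsLimit.hom_ext (hc q) _ _ fun i => by
      dsimp
      rw [hh, (H i).zero p q hpq, zero_comp]
    comm n := Fan.IsLimit.hom_ext (hc n) _ _ fun i => by
      have := (H i).comm n
      rw [dNext_eq _ (i' := n + 1) (by simp), prevD_eq _ (j' := n - 1) (by simp)] at this ⊢
      dsimp at this ⊢
      simp only [add_zero, Preadditive.add_comp, Category.assoc] at this ⊢
      rw [this, hh, ← HomologicalComplex.Hom.comm, reassoc_of% (hh n (n - 1) i)] }⟩

end HomotopyClasses

lemma containsZero_of_isClosedUnderFiniteCoproducts {C : Type u} [Category.{v} C] [Abelian C]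
    (X : ObjectProperty C) [X.IsClosedUnderFiniteCoproducts] : X.ContainsZero where
  exists_zero := ⟨∐ (PEmpty.elim : PEmpty.{1} → C),
    (IsZero.iff_id_eq_zero _).2 (Sigma.hom_ext _ _ fun j => j.elim),
    X.prop_coproduct (by rintro ⟨⟩)⟩

/-! ### Relative acyclicity as a lifting property. -/

section HomAcyclic

variable {A : Type u} [Category.{v} A] [Abelian A]

lemma isRightAcyclic_iff (X : ObjectProperty A) {ι : Type*} {c : ComplexShape ι}
    (K : HomologicalComplex A c) :
    IsRightAcyclic X K ↔ ∀ M, X M → ∀ i j k, c.prev j = i → c.next j = k →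
      ∀ x : M ⟶ K.X j, x ≫ K.d j k = 0 → ∃ y : M ⟶ K.X i, y ≫ K.d i j = x := by
  refine forall_congr' fun M => forall_congr' fun hM => ⟨?_, ?_⟩
  · intro h i j k hi hk x hx
    have := (ShortComplex.ab_exact_iff _).1
      ((HomologicalComplex.exactAt_iff' _ i j k hi hk).1 (h j)) x hx
    exact this
  · intro h j
    rw [HomologicalComplex.exactAt_iff' _ _ _ _ rfl rfl, ShortComplex.ab_exact_iff]
    exact fun x hx => h _ j _ rfl rfl x hx

lemma IsLeftAcyclic.exists_desc {Y : ObjectProperty A} {ι : Type*} {c : ComplexShape ι}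
    {K : HomologicalComplex A c} (h : IsLeftAcyclic Y K) {N : A} (hN : Y N) {i j k : ι}
    (hi : c.prev j = i) (hk : c.next j = k) (x : K.X j ⟶ N) (hx : K.d i j ≫ x = 0) :
    ∃ y : K.X k ⟶ N, K.d j k ≫ y = x :=
  (ShortComplex.ab_exact_iff _).1
    ((HomologicalComplex.exactAt_iff' _ k j i (show c.symm.prev j = k from hk)
      (show c.symm.next j = i from hi)).1
      (h N hN j)) x hx

end HomAcyclic

/-! ### Homotopies built degree by degree, and closure properties of relative acyclicity. -/

namespace CochainComplex

open HomComplex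

section

variable {C : Type u} [Category.{v} C] [Preadditive C]

/-- The defect `u` of the homotopy relation in degree `n + 1` is killed by the incoming differential
of `K`, because the relation holds in degree `n`. The hypothesis factors `u` through the outgoing
differential, and that factor is the next component of the homotopy. -/
lemma exists_homotopy_extension {K L : CochainComplex C ℤ}
    (f : K ⟶ L) (α : Cochain K L (-1)) (n m : ℤ) (hnm : n + 1 = m)
    (h : ∀ x : K.X m ⟶ L.X m, K.d n m ≫ x = 0 →
      ∃ y : K.X (m + 1) ⟶ L.X m, K.d m (m + 1) ≫ y = x)
    (hα : (δ (-1) 0 α).EqUpTo (Cochain.ofHom f) n) :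
    ∃ (h : K.X (n + 2) ⟶ L.X (n + 1)),
      (δ (-1) 0 (α + Cochain.single h (-1))).EqUpTo (Cochain.ofHom f) m := by
  subst hnm
  let u := f.f (n + 1) - α.v (n + 1) n (by lia) ≫ L.d n (n + 1) -
    K.d (n + 1) (n + 2) ≫ α.v (n + 2) (n + 1) (by lia)
  have hu : K.d n (n + 1) ≫ u = 0 := by
    have eq := hα n n (add_zero n) (by rfl)
    simp only [δ_v (-1) 0 (neg_add_cancel 1) α n n (add_zero _) (n - 1) (n + 1)
      (by lia) (by lia), Int.negOnePow_zero, one_smul, Cochain.ofHom_v] at eq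
    simp only [u, Preadditive.comp_sub, HomologicalComplex.d_comp_d_assoc, zero_comp,
      ← f.comm, ← eq, Preadditive.add_comp, Category.assoc, L.d_comp_d, comp_zero, zero_add,
      sub_self]
  obtain ⟨β, hβ⟩ : ∃ (β : K.X (n + 2) ⟶ L.X (n + 1)), K.d (n + 1) (n + 2) ≫ β = u := by
    have := h u hu
    rwa [show n + 1 + 1 = n + 2 by lia] at this
  refine ⟨β, ?_⟩
  intro p q hpq hp
  obtain rfl : p = q := by lia
  obtain hp | rfl := hp.lt_or_eq
  · rw [δ_add, Cochain.add_v, hα p p (by lia) (by lia), add_eq_left,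
      δ_v (-1) 0 (neg_add_cancel 1) _ p p hpq (p - 1) (p + 1) rfl rfl,
      Cochain.single_v_eq_zero _ _ _ _ _ (by lia),
      Cochain.single_v_eq_zero _ _ _ _ _ (by lia)]
    simp
  · rw [δ_v (-1) 0 (neg_add_cancel 1) _ (n + 1) (n + 1) (by lia) n (n + 2)
      (by lia) (by lia), Cochain.add_v,
      Cochain.single_v_eq_zero _ _ _ _ _ (by lia)]
    simp [hβ, u]

open Cochain.InductionUp in
/-- A morphism of cochain complexes which vanishes in low degrees is nullhomotopic if the
obstructions to the inductive construction of a homotopy vanish. -/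
lemma nonempty_homotopy_zero_of_up {K L : CochainComplex C ℤ} (f : K ⟶ L) (d : ℤ)
    (hd : ∀ n < d, f.f n = 0)
    (h : ∀ n : ℤ, ∀ x : K.X n ⟶ L.X n, K.d (n - 1) n ≫ x = 0 →
      ∃ y : K.X (n + 1) ⟶ L.X n, K.d n (n + 1) ≫ y = x) :
    Nonempty (Homotopy f 0) := by
  let X (n : ℕ) : Set (Cochain K L (-1)) :=
    Set.ofPred (fun α => (δ (-1) 0 α).EqUpTo (Cochain.ofHom f) (n + d - 1))
  let x₀ : X 0 := ⟨0, fun p q hpq hp ↦ by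
    obtain rfl : p = q := by lia
    simp [hd p (by lia)]⟩
  let φ (n : ℕ) (α : X n) : X (n + 1) :=
    ⟨_, (exists_homotopy_extension f α.1 (n + d - 1) ((n + 1 : ℕ) + d - 1)
      (by lia) (by
        rw [show (n + d - 1 : ℤ) = (n + 1 : ℕ) + d - 1 - 1 by lia]
        exact h _) α.2).choose_spec⟩
  have hφ (k : ℕ) (x : X k) : (φ k x).1.EqUpTo x.1 (d + k) := fun p q hpq hp => by
    dsimp [φ]
    rw [add_eq_left, Cochain.single_v_eq_zero _ _ _ _ _ (by lia)]
  refine ⟨(Cochain.equivHomotopy f 0).symm ⟨limitSequence φ hφ x₀, ?_⟩⟩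
  rw [Cochain.ofHom_zero, add_zero]
  ext n
  let k₀ := (n - d + 1).toNat
  rw [← (sequence φ x₀ k₀).2 n n (add_zero n) (by lia),
    δ_v (-1) 0 (neg_add_cancel 1) _ n n (by lia) (n - 1) (n + 1) rfl (by lia),
    δ_v (-1) 0 (neg_add_cancel 1) _ n n (by lia) (n - 1) (n + 1) rfl (by lia),
    limitSequence_eqUpTo φ hφ x₀ k₀ n (n - 1) (by lia) (by lia),
    limitSequence_eqUpTo φ hφ x₀ k₀ (n + 1) n (by lia) (by lia)]

lemma nonempty_homotopy_zero_of_down {K L : CochainComplex C ℤ} (f : K ⟶ L) (d : ℤ)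
    (hd : ∀ n, d < n → f.f n = 0)
    (h : ∀ n m : ℤ, n + 1 = m → ∀ x : K.X n ⟶ L.X n, x ≫ L.d n m = 0 →
      ∀ l, l + 1 = n → ∃ y : K.X n ⟶ L.X l, y ≫ L.d l n = x) :
    Nonempty (Homotopy f 0) := by
  have := nonempty_homotopy_zero_of_up ((opEquivalence C).functor.map f.op) (-d)
    (fun n hn => congr_arg Quiver.Hom.op (hd (-n) (by lia))) (fun n x hx => by
      obtain ⟨y, hy⟩ := h (-n) (-(n - 1)) (by lia) x.unop (congr_arg Quiver.Hom.unop hx)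
        (-(n + 1)) (by lia)
      exact ⟨y.op, congr_arg Quiver.Hom.op hy⟩)
  exact ⟨homotopyUnop (this.some.trans (.ofEq (by simp)))⟩

end

section

variable {C : Type u} [Category.{v} C] [Abelian C]

/-- A cochain complex `K` such that `Hom(M, K)` is exact for all `M` in `X`. -/
def relAcyclic (X : ObjectProperty C) : ObjectProperty (CochainComplex C ℤ) :=
  fun K => ∀ M, X M → ∀ i j k, i + 1 = j → j + 1 = k → ∀ x : M ⟶ K.X j, x ≫ K.d j k = 0 →
    ∃ y : M ⟶ K.X i, y ≫ K.d i j = x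

/-- The cochain complexes with all terms in `X`. -/
def termwise (X : ObjectProperty C) : ObjectProperty (CochainComplex C ℤ) :=
  fun K => ∀ n, X (K.X n)

lemma isDegreewiseSplitThick_relAcyclic (X : ObjectProperty C) :
    IsDegreewiseSplitThick (relAcyclic X) where
  zero := ⟨_, isZero_zero _, fun M _ i j k _ _ x _ =>
    ⟨0, ((HomologicalComplex.eval C _ j).map_isZero (isZero_zero _)).eq_of_tgt _ _⟩⟩
  shift K n hK M hM i j k hi hj x hx := by
    change M ⟶ K.X (j + n) at x
    change x ≫ (n.negOnePow • K.d (j + n) (k + n)) = 0 at hx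
    have hx' : x ≫ K.d (j + n) (k + n) = 0 := by
      rwa [Linear.comp_units_smul, smul_eq_zero_iff_eq] at hx
    obtain ⟨y, hy⟩ := hK M hM (i + n) (j + n) (k + n) (by lia) (by lia) x hx'
    refine ⟨n.negOnePow • y, ?_⟩
    change (n.negOnePow • y) ≫ (n.negOnePow • K.d (i + n) (j + n)) = x
    rw [Linear.comp_units_smul, Linear.units_smul_comp,
      smul_smul, Int.units_mul_self, one_smul]
    exact hy
  ext S σ h₁ h₃ M hM i j k hi hj x hx := by
    obtain ⟨r, hr⟩ : ∃ r : S.X₂.X j ⟶ S.X₁.X j, ∃ s : S.X₃.X j ⟶ S.X₂.X j,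
        r ≫ S.f.f j + S.g.f j ≫ s = 𝟙 _ := ⟨(σ j).some.r, (σ j).some.s, (σ j).some.id⟩
    obtain ⟨s', hr⟩ := hr
    obtain ⟨s, hs⟩ : ∃ s : S.X₃.X i ⟶ S.X₂.X i, s ≫ S.g.f i = 𝟙 _ :=
      ⟨(σ i).some.s, (σ i).some.s_g⟩
    have hf (l : ℤ) : Mono (S.f.f l) := (σ l).some.mono_f
    obtain ⟨y₃, hy₃⟩ := h₃ M hM i j k hi hj (x ≫ S.g.f j) (by
      rw [Category.assoc, S.g.comm, reassoc_of% hx, zero_comp])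
    -- Correcting `x` by the boundary of a lift of `y₃` moves it into the subcomplex `S.X₁`, where
    -- `h₁` applies.
    have hx' : (x - y₃ ≫ s ≫ S.X₂.d i j) ≫ S.g.f j = 0 := by
      simp only [Preadditive.sub_comp, Category.assoc, ← S.g.comm, reassoc_of% hs, hy₃, sub_self]
    have hx'' : (x - y₃ ≫ s ≫ S.X₂.d i j) ≫ r ≫ S.f.f j = x - y₃ ≫ s ≫ S.X₂.d i j := by
      have := (x - y₃ ≫ s ≫ S.X₂.d i j) ≫= hr
      rwa [Preadditive.comp_add, reassoc_of% hx', zero_comp, add_zero, Category.comp_id] at this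
    obtain ⟨y₁, hy₁⟩ := h₁ M hM i j k hi hj ((x - y₃ ≫ s ≫ S.X₂.d i j) ≫ r) (by
      rw [← cancel_mono (S.f.f k), Category.assoc, Category.assoc, ← S.f.comm, zero_comp,
        reassoc_of% hx'']
      simp [hx])
    refine ⟨y₁ ≫ S.f.f i + y₃ ≫ s, ?_⟩
    rw [Preadditive.add_comp, Category.assoc, S.f.comm, reassoc_of% hy₁, Category.assoc, hx'']
    simp

lemma isDegreewiseSplitThick_termwise (X : ObjectProperty C) [X.IsClosedUnderFiniteCoproducts]
    [X.IsClosedUnderIsomorphisms] : IsDegreewiseSplitThick (termwise X) where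
  zero := ⟨_, isZero_zero _, fun n =>
    have := containsZero_of_isClosedUnderFiniteCoproducts X
    X.prop_of_isZero ((HomologicalComplex.eval C _ n).map_isZero (isZero_zero _))⟩
  shift K n hK i := hK (i + n)
  ext S σ h₁ h₃ n := by
    have e := (σ n).some.isoBinaryBiproduct
    exact X.prop_of_iso e.symm
      (X.prop_of_isColimit_binaryCofan (BinaryBiproduct.isColimit _ _) (h₁ n) (h₃ n))

lemma relAcyclic_of_homotopyEquiv (X : ObjectProperty C) {K L : CochainComplex C ℤ}
    (e : HomotopyEquiv K L) (hK : relAcyclic X K) : relAcyclic X L := by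
  intro M hM i j k hi hj x hx
  obtain ⟨y, hy⟩ := hK M hM i j k hi hj (x ≫ e.inv.f j) (by
    rw [Category.assoc, e.inv.comm, reassoc_of% hx, zero_comp])
  have h := e.homotopyInvHomId.comm j
  rw [dNext_eq _ (i' := k) (by simpa using hj), prevD_eq _ (j' := i) (by simpa using hi)] at h
  have h' := x ≫= h
  refine ⟨y ≫ e.hom.f i - x ≫ e.homotopyInvHomId.hom j i, ?_⟩
  rw [Preadditive.sub_comp, Category.assoc, e.hom.comm, reassoc_of% hy, Category.assoc]
  simp only [HomologicalComplex.comp_f, Preadditive.comp_add, reassoc_of% hx, zero_comp,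
    HomologicalComplex.id_f, Category.comp_id, zero_add] at h'
  rw [h', add_sub_cancel_left]

lemma relAcyclic_pi (X : ObjectProperty C) {ι : Type*} [HasLimitsOfShape (Discrete ι) C]
    (K : ι → CochainComplex C ℤ) (hK : ∀ i, relAcyclic X (K i)) : relAcyclic X (∏ᶜ K) := by
  intro M hM i j k hi hj x hx
  have hc (n : ℤ) : IsLimit (Fan.mk ((∏ᶜ K).X n) fun i => (Pi.π K i).f n) :=
    isLimitFanMkObjOfIsLimit (HomologicalComplex.eval C _ n) _ _ (productIsProduct K)
  choose y hy using fun a => hK a M hM i j k hi hj (x ≫ (Pi.π K a).f j) (by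
    rw [Category.assoc, (Pi.π K a).comm, reassoc_of% hx, zero_comp])
  refine ⟨Fan.IsLimit.lift (hc i) y, Fan.IsLimit.hom_ext (hc j) _ _ fun a => ?_⟩
  have := Fan.IsLimit.fac (hc i) y a
  dsimp at this ⊢
  rw [Category.assoc, ← (Pi.π K a).comm, reassoc_of% this, hy]

/-- A cycle `x : M ⟶ K.X j` is a morphism to `K` from the stalk of `M` in degree `j`; a nullhomotopy
of it exhibits `x` as a boundary. -/
lemma relAcyclic_of_rightOrthogonal (X : ObjectProperty C) [X.IsClosedUnderFiniteCoproducts]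
    [X.IsClosedUnderIsomorphisms] (K : CochainComplex C ℤ)
    (h : ∀ (L : CochainComplex C ℤ) (f : L ⟶ K), termwise X L → Nonempty (Homotopy f 0)) :
    relAcyclic X K := by
  intro M hM i j k hi hj x hx
  have := containsZero_of_isClosedUnderFiniteCoproducts X
  obtain ⟨H⟩ := h ((HomologicalComplex.single C _ j).obj M)
    (HomologicalComplex.mkHomFromSingle x (fun k' hk' => by
      obtain rfl : k' = k := by simp at hk'; lia
      exact hx)) (fun n => by
        by_cases hn : n = j
        · subst hn
          exact X.prop_of_iso (HomologicalComplex.singleObjXSelf _ n M).symm hM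
        · exact X.prop_of_isZero (HomologicalComplex.isZero_single_obj_X _ _ _ _ hn))
  have := H.comm j
  rw [dNext_eq _ (i' := k) (by simpa using hj), prevD_eq _ (j' := i) (by simpa using hi)] at this
  refine ⟨(HomologicalComplex.singleObjXSelf (.up ℤ) j M).inv ≫ H.hom j i, ?_⟩
  rw [← cancel_epi (HomologicalComplex.singleObjXSelf (.up ℤ) j M).hom]
  simpa using this.symm

end

end CochainComplex

/-- Each inclusion into the coproduct factors through its approximation, so the coproduct is a
retract of an object of `X`. -/
lemma isClosedUnderCoproducts_of_rightApproximation {C : Type u} [Category.{v} C]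
    {X : ObjectProperty C} [X.IsStableUnderRetracts]
    (h : ∀ M : C, ∃ (M₀ : C) (f : M₀ ⟶ M), IsRightApproximation X f)
    {ι : Type*} [HasColimitsOfShape (Discrete ι) C] (M : ι → C) (hM : ∀ i, X (M i)) :
    X (∐ M) := by
  obtain ⟨P, p, hP, hp⟩ := h (∐ M)
  choose s hs using fun i => hp (M i) (Sigma.ι M i) (hM i)
  exact X.prop_of_retract { i := Limits.Sigma.desc s, r := p } hP

/-! ### Balance, decomposition of stalk complexes, and the combined decomposition. -/

namespace CochainComplex

open HomComplex Pretriangulated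

variable {C : Type u} [Category.{v} C] [Abelian C] {X Y : ObjectProperty C}

lemma relAcyclic_extend {ι : Type*} {c : ComplexShape ι} (e : c.Embedding (.up ℤ))
    {R : HomologicalComplex C c} (hR : IsRightAcyclic X R) : relAcyclic X (R.extend e) := by
  rw [isRightAcyclic_iff] at hR
  intro M hM i j k hi hj x hx
  by_cases! h : ∃ b, e.f b = j
  · obtain ⟨b, hb⟩ := h
    obtain ⟨y, hy⟩ := hR M hM _ b _ rfl rfl (x ≫ (R.extendXIso e hb).hom) (by
      by_cases hbk : c.Rel b (c.next b)
      · have hk : e.f (c.next b) = k := by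
          have := e.rel hbk
          simp [hb] at this
          lia
        rw [R.extend_d_eq e hb hk] at hx
        rw [← cancel_mono (R.extendXIso e hk).inv]
        simpa using hx
      · rw [R.shape _ _ hbk, comp_zero])
    by_cases hib : c.Rel (c.prev b) b
    · have hi' : e.f (c.prev b) = i := by
        have := e.rel hib
        simp [hb] at this
        lia
      refine ⟨y ≫ (R.extendXIso e hi').inv, ?_⟩
      rw [R.extend_d_eq e hi' hb]
      simp [reassoc_of% hy]
    · rw [R.shape _ _ hib, comp_zero] at hy
      refine ⟨0, ?_⟩
      rw [← cancel_mono (R.extendXIso e hb).hom, ← hy]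
      simp
  · exact ⟨0, (R.isZero_extend_X e j h).eq_of_tgt _ _⟩

lemma nonempty_iso_of_stalk (K L : CochainComplex C ℤ) (n : ℤ)
    [K.IsStrictlyGE n] [K.IsStrictlyLE n] [L.IsStrictlyGE n] [L.IsStrictlyLE n]
    (e : K.X n ≅ L.X n) : Nonempty (K ≅ L) := by
  obtain ⟨M, ⟨eK⟩⟩ := K.exists_iso_single n
  obtain ⟨N, ⟨eL⟩⟩ := L.exists_iso_single n
  let e' : M ≅ N := (HomologicalComplex.singleObjXSelf (.up ℤ) n M).symm ≪≫
    ((HomologicalComplex.eval C _ n).mapIso eK).symm ≪≫ e ≪≫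
    (HomologicalComplex.eval C _ n).mapIso eL ≪≫ HomologicalComplex.singleObjXSelf (.up ℤ) n N
  exact ⟨eK ≪≫ (singleFunctor C n).mapIso e' ≪≫ eL.symm⟩

/-- If `K` is `Hom(X, -)`-acyclic and objects have resolutions which are both right `X`-acyclic
and left `Y`-acyclic, then `K` is `Hom(-, Y)`-acyclic. -/
lemma relAcyclic.exists_desc (hX : ∀ M : C, ∃ (P : C) (p : P ⟶ M), X P ∧ Epi p)
    (hres : ∀ M : C, ∃ K : ChainComplex C ℕ, Nonempty (K.X 0 ≅ M) ∧
      (∀ n, X (K.X (n + 1))) ∧ IsRightAcyclic X K ∧ IsLeftAcyclic Y K)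
    {K : CochainComplex C ℤ} (hK : relAcyclic X K) {N : C} (hN : Y N) {i j k : ℤ}
    (hi : i + 1 = j) (hj : j + 1 = k) (φ : K.X j ⟶ N) (hφ : K.d i j ≫ φ = 0) :
    ∃ ψ : K.X k ⟶ N, K.d j k ≫ ψ = φ := by
  obtain ⟨R, ⟨e⟩, hRX, hR, hRY⟩ := hres (kernel (K.d (k + 1) (k + 2)))
  rw [isRightAcyclic_iff] at hR
  have hR₀ (P : C) (hP : X P) (x : P ⟶ R.X 0) : ∃ y, y ≫ R.d 1 0 = x :=
    hR P hP 1 0 _ (by simp) rfl x (by rw [R.shape _ _ (by simp), comp_zero])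
  have hR₁ (P : C) (hP : X P) (x : P ⟶ R.X 1) (hx : x ≫ R.d 1 0 = 0) :
      ∃ y, y ≫ R.d 2 1 = x :=
    hR P hP 2 1 0 (by simp) (by simp) x hx
  let u : R.X 1 ⟶ K.X (k + 1) := R.d 1 0 ≫ e.hom ≫ kernel.ι _
  have hd21 : R.d 2 1 ≫ u = 0 := by simp [u]
  -- The `tᵢ` are a comparison map from the resolution of the cycles in degree `k + 1` to `K`. As
  -- `t₁ ≫ φ` is killed by `R.d 3 2`, left `Y`-acyclicity of `R` produces `h`.
  obtain ⟨t₀, ht₀⟩ := hK _ (hRX 0) k (k + 1) (k + 2) rfl (by lia) u (by simp [u])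
  obtain ⟨t₁, ht₁⟩ := hK _ (hRX 1) j k (k + 1) hj rfl (R.d 2 1 ≫ t₀) (by
    rw [Category.assoc, ht₀, hd21])
  obtain ⟨t₂, ht₂⟩ := hK _ (hRX 2) i j k hi hj (R.d 3 2 ≫ t₁) (by
    rw [Category.assoc, ht₁, R.d_comp_d_assoc, zero_comp])
  obtain ⟨h, hh⟩ := hRY.exists_desc hN (i := 3) (j := 2) (k := 1) (by simp) (by simp)
    (t₁ ≫ φ) (by rw [← reassoc_of% ht₂, hφ, comp_zero])
  -- `g` presents `K.X k` as a quotient, so `ψ` may be defined by descending `(h, φ)`. That `g` is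
  -- epi and that `(h, φ)` kills its kernel are both tested on epimorphisms from objects of `X`.
  let g : R.X 1 ⊞ K.X j ⟶ K.X k := biprod.desc t₀ (K.d j k)
  have hg : Epi g := by
    obtain ⟨P, p, hP, hp⟩ := hX (K.X k)
    obtain ⟨a, ha⟩ := hR₀ P hP (kernel.lift (K.d (k + 1) (k + 2)) (p ≫ K.d k (k + 1))
      (by simp) ≫ e.inv)
    have hau : a ≫ u = p ≫ K.d k (k + 1) := by
      simp [u, reassoc_of% ha]
    obtain ⟨b, hb⟩ := hK P hP j k (k + 1) hj rfl (p - a ≫ t₀) (by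
      rw [Preadditive.sub_comp, Category.assoc, ht₀, hau, sub_self])
    have : biprod.lift a b ≫ g = p := by simp [g, hb]
    exact epi_of_epi_fac this
  have hker : kernel.ι g ≫ biprod.desc h φ = 0 := by
    obtain ⟨P, p, hP, hp⟩ := hX (kernel g)
    rw [← cancel_epi p, comp_zero]
    obtain ⟨a, b, hab⟩ : ∃ (a : P ⟶ R.X 1) (b : P ⟶ K.X j), p ≫ kernel.ι g = biprod.lift a b :=
      ⟨p ≫ kernel.ι g ≫ biprod.fst, p ≫ kernel.ι g ≫ biprod.snd, by ext <;> simp⟩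
    have h₁ : a ≫ t₀ + b ≫ K.d j k = 0 := by
      have : (p ≫ kernel.ι g) ≫ g = 0 := by simp
      rw [hab] at this
      simpa [g] using this
    have h₂ : a ≫ R.d 1 0 = 0 := by
      have : (a ≫ t₀ + b ≫ K.d j k) ≫ K.d k (k + 1) = 0 := by rw [h₁, zero_comp]
      rw [Preadditive.add_comp, Category.assoc, ht₀, Category.assoc, K.d_comp_d, comp_zero,
        add_zero] at this
      rw [← cancel_mono (e.hom ≫ kernel.ι (K.d (k + 1) (k + 2)))]
      simpa [u] using this
    obtain ⟨a', ha'⟩ := hR₁ P hP a h₂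
    obtain ⟨b', hb'⟩ := hK P hP i j k hi hj (b + a' ≫ t₁) (by
      rw [Preadditive.add_comp, Category.assoc, ht₁, reassoc_of% ha', add_comm, h₁])
    rw [reassoc_of% hab, biprod.lift_desc, ← ha', Category.assoc, hh, ← Category.assoc,
      ← Preadditive.add_comp, add_comm, ← hb', Category.assoc, hφ, comp_zero]
  refine ⟨Abelian.epiDesc g (biprod.desc h φ) hker, ?_⟩
  have := biprod.inr ≫= Abelian.comp_epiDesc g (biprod.desc h φ) hker
  rwa [← Category.assoc, biprod.inr_desc, biprod.inr_desc] at this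

section

variable (X) in
/-- The `Hom(X, -)`-acyclic cochain complexes with terms in `X`. -/
def termwiseRelAcyclic : ObjectProperty (CochainComplex C ℤ) :=
  fun K => termwise X K ∧ relAcyclic X K

variable (X) in
lemma isDegreewiseSplitThick_termwiseRelAcyclic [X.IsClosedUnderFiniteCoproducts]
    [X.IsClosedUnderIsomorphisms] : IsDegreewiseSplitThick (termwiseRelAcyclic X) where
  zero := by
    obtain ⟨Z, hZ, h⟩ := (isDegreewiseSplitThick_termwise X).zero
    exact ⟨Z, hZ, h, fun M hM i j k _ _ x _ =>
      ⟨0, ((HomologicalComplex.eval C _ j).map_isZero hZ).eq_of_tgt _ _⟩⟩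
  shift K n hK := ⟨(isDegreewiseSplitThick_termwise X).shift K n hK.1,
    (isDegreewiseSplitThick_relAcyclic X).shift K n hK.2⟩
  ext S σ h₁ h₃ := ⟨(isDegreewiseSplitThick_termwise X).ext S σ h₁.1 h₃.1,
    (isDegreewiseSplitThick_relAcyclic X).ext S σ h₁.2 h₃.2⟩

/-- The augmented resolution `K`, with `M` in its top degree `n`, is an extension of a complex with
terms in `X` by the stalk. Being bounded above and right `X`-acyclic, `K` receives only
nullhomotopic maps from complexes with terms in `X`: homotopies are built downwards. -/
lemma stalk_mem_extensionProduct_termwise [X.IsClosedUnderFiniteCoproducts]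
    [X.IsClosedUnderIsomorphisms]
    (hres : ∀ M : C, ∃ K : ChainComplex C ℕ, Nonempty (K.X 0 ≅ M) ∧
      (∀ n, X (K.X (n + 1))) ∧ IsRightAcyclic X K)
    (M : CochainComplex C ℤ) (n : ℤ) [M.IsStrictlyGE n] [M.IsStrictlyLE n] :
    (homotopyClass (termwise X)).extensionProduct (homotopyClass (termwise X)).rightOrthogonal
      ((HomotopyCategory.quotient C (.up ℤ)).obj M) := by
  have := containsZero_of_isClosedUnderFiniteCoproducts X
  obtain ⟨R, ⟨e⟩, hRX, hR⟩ := hres (M.X n)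
  let ε := ComplexShape.embeddingUpIntLE n
  let K : CochainComplex C ℤ := R.extend ε
  have hε (k : ℤ) (hk : k ≤ n) : ε.f (n - k).toNat = k := by
    change n - ((n - k).toNat : ℤ) = k
    lia
  have hK₀ (k : ℤ) (hk : n < k) : IsZero (K.X k) := R.isZero_extend_X ε k (fun i hi => by
    change n - (i : ℤ) = k at hi
    lia)
  have hK : relAcyclic X K := relAcyclic_extend ε hR
  have : K.IsStrictlyLE n := (isStrictlyLE_iff _ _).2 hK₀
  have := K.isStrictlyLE_brutalGE n n
  have := K.isIso_brutalGEι_f (le_refl n)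
  obtain ⟨φ⟩ := nonempty_iso_of_stalk M (K.brutalGE n) n
    (e.symm ≪≫ (R.extendXIso ε (by change n - ((0 : ℕ) : ℤ) = n; simp)).symm ≪≫
      (asIso ((K.brutalGEι n).f n)).symm)
  refine ObjectProperty.prop_of_iso _ ((HomotopyCategory.quotient C (.up ℤ)).mapIso φ.symm) ?_
  refine (extensionProduct_rightOrthogonal_iff (isDegreewiseSplitThick_termwise X) _).2
    ⟨_, _, _, _, _, K.brutalShortComplex_splitting n, ?_, fun k => ?_⟩
  · rw [rightOrthogonal_homotopyClass_iff]
    exact fun L f hL => nonempty_homotopy_zero_of_down f n (fun k hk => (hK₀ k hk).eq_of_tgt _ _)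
      (fun j k hj x hx i hi => hK _ (hL j) i j k hi hj x hx)
  · by_cases hk : n ≤ k
    · exact X.prop_of_isZero (K.isZero_brutalShortComplex_X₃ hk)
    · have := K.isIso_brutalShortComplex_g_f (p := n) (k := k) (by lia)
      refine X.prop_of_iso (@asIso _ _ _ _ ((K.brutalShortComplex n).g.f k) this)
        (X.prop_of_iso (R.extendXIso ε (hε k (by lia))).symm ?_)
      obtain ⟨m, hm⟩ : ∃ m, (n - k).toNat = m + 1 := ⟨(n - k).toNat - 1, by lia⟩
      rw [hm]
      exact hRX m

/-- The stalk is the quotient of the augmented coresolution `K`, which is right `X`-acyclic, by its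
part with terms in `Y`. That part is bounded below and right orthogonal: by `relAcyclic.exists_desc`
homotopies into it can be built upwards. -/
lemma stalk_mem_extensionProduct_relAcyclic [Y.IsClosedUnderFiniteCoproducts]
    [Y.IsClosedUnderIsomorphisms] (hX : ∀ M : C, ∃ (P : C) (p : P ⟶ M), X P ∧ Epi p)
    (hres : ∀ M : C, ∃ K : ChainComplex C ℕ, Nonempty (K.X 0 ≅ M) ∧
      (∀ n, X (K.X (n + 1))) ∧ IsRightAcyclic X K ∧ IsLeftAcyclic Y K)
    (hcores : ∀ N : C, ∃ K : CochainComplex C ℕ, Nonempty (K.X 0 ≅ N) ∧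
      (∀ n, Y (K.X (n + 1))) ∧ IsRightAcyclic X K)
    (M : CochainComplex C ℤ) (n : ℤ) [M.IsStrictlyGE n] [M.IsStrictlyLE n] :
    (homotopyClass (relAcyclic X)).extensionProduct (homotopyClass (relAcyclic X)).rightOrthogonal
      ((HomotopyCategory.quotient C (.up ℤ)).obj M) := by
  have := containsZero_of_isClosedUnderFiniteCoproducts Y
  obtain ⟨R, ⟨e⟩, hRY, hR⟩ := hcores (M.X n)
  let ε := ComplexShape.embeddingUpIntGE n
  let K : CochainComplex C ℤ := R.extend ε
  have hε (k : ℤ) (hk : n ≤ k) : ε.f (k - n).toNat = k := by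
    change n + ((k - n).toNat : ℤ) = k
    lia
  have hK₀ (k : ℤ) (hk : k < n) : IsZero (K.X k) := R.isZero_extend_X ε k (fun i hi => by
    change n + (i : ℤ) = k at hi
    lia)
  have hK : relAcyclic X K := relAcyclic_extend ε hR
  have hT := (isDegreewiseSplitThick_relAcyclic X).isTriangulated
  have hK₁ (k : ℤ) (hk : k < n + 1) := K.isIso_brutalShortComplex_g_f hk
  have : (K.brutalShortComplex (n + 1)).X₃.IsStrictlyLE n := (isStrictlyLE_iff _ _).2
    fun k hk => K.isZero_brutalShortComplex_X₃ (by lia)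
  have : (K.brutalShortComplex (n + 1)).X₃.IsStrictlyGE n := (isStrictlyGE_iff _ _).2
    fun k hk => by
      have := hK₁ k (by lia)
      exact (hK₀ k hk).of_iso (@asIso _ _ _ _ ((K.brutalShortComplex (n + 1)).g.f k) this).symm
  have := hK₁ n (by lia)
  obtain ⟨φ⟩ := nonempty_iso_of_stalk M (K.brutalShortComplex (n + 1)).X₃ n
    (e.symm ≪≫ (R.extendXIso ε (by change n + ((0 : ℕ) : ℤ) = n; simp)).symm ≪≫
      (@asIso _ _ _ _ ((K.brutalShortComplex (n + 1)).g.f n) this))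
  refine ObjectProperty.prop_of_iso _ ((HomotopyCategory.quotient C (.up ℤ)).mapIso φ.symm) ?_
  refine (degreewiseSplitTwoOutOfThree ((homotopyClass (relAcyclic X)).extensionProduct
    (homotopyClass (relAcyclic X)).rightOrthogonal)).prop_X₃ _
      (K.brutalShortComplex_splitting (n + 1)) ?_ ?_
  · refine ObjectProperty.le_extensionProduct_right _ _ ?_
    rw [rightOrthogonal_homotopyClass_iff]
    refine fun L f hL => nonempty_homotopy_zero_of_up f (n + 1)
      (fun k hk => (K.isZero_brutalGE_X hk).eq_of_tgt _ _) (fun j x hx =>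
        hL.exists_desc hX hres (N := (K.brutalGE (n + 1)).X j) ?_ (by lia) rfl x hx)
    by_cases hj : n + 1 ≤ j
    · have := K.isIso_brutalGEι_f hj
      refine Y.prop_of_iso (asIso ((K.brutalGEι (n + 1)).f j)).symm
        (Y.prop_of_iso (R.extendXIso ε (hε j (by lia))).symm ?_)
      obtain ⟨m, hm⟩ : ∃ m, (j - n).toNat = m + 1 := ⟨(j - n).toNat - 1, by lia⟩
      rw [hm]
      exact hRY m
    · exact Y.prop_of_isZero (K.isZero_brutalGE_X (by lia))
  · exact ObjectProperty.le_extensionProduct_left _ _ (ObjectProperty.prop_map_obj _ _ hK)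

lemma termwise_coproduct [X.IsClosedUnderIsomorphisms] {ι : Type*}
    [HasColimitsOfShape (Discrete ι) C] (hX : ∀ M : ι → C, (∀ i, X (M i)) → X (∐ M))
    (K : ι → CochainComplex C ℤ) (hK : ∀ i, termwise X (K i)) : termwise X (∐ K) :=
  fun n => X.prop_of_iso (PreservesCoproduct.iso (HomologicalComplex.eval C _ n) K).symm
    (hX _ fun i => hK i n)

/-- The semiorthogonal decomposition of the homotopy category given by the right `X`-acyclic
complexes with terms in `X`: every complex `M` fits in a degreewise split exact sequence
`M ⟶ V ⟶ U` with `U` right `X`-acyclic with terms in `X`, and `V` right orthogonal to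
such complexes. -/
lemma exists_termwiseRelAcyclic_preenvelope [HasLimitsOfShape (Discrete ℕ) C]
    [HasColimitsOfShape (Discrete ℕ) C]
    [X.IsClosedUnderFiniteCoproducts] [Y.IsClosedUnderFiniteCoproducts]
    [X.IsStableUnderRetracts] [Y.IsClosedUnderIsomorphisms] (hXY : IsAdmissibleBalancedPair X Y)
    (hV : ∀ V : ℕ → CochainComplex C ℤ,
      (∀ i, (homotopyClass (termwise X)).rightOrthogonal
        ((HomotopyCategory.quotient C (.up ℤ)).obj (V i))) →
        (homotopyClass (termwise X)).rightOrthogonal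
          ((HomotopyCategory.quotient C (.up ℤ)).obj (∐ V)))
    (M : CochainComplex C ℤ) :
    ∃ (V U : CochainComplex C ℤ) (f : M ⟶ V) (g : V ⟶ U) (zero : f ≫ g = 0),
      (∀ n, Nonempty ((ShortComplex.mk f g zero).map
        (HomologicalComplex.eval C _ n)).Splitting) ∧
      (∀ (L : CochainComplex C ℤ) (φ : L ⟶ V), termwiseRelAcyclic X L →
        Nonempty (Homotopy φ 0)) ∧ termwiseRelAcyclic X U := by
  have hepi (M : C) : ∃ (P : C) (p : P ⟶ M), X P ∧ Epi p := by
    obtain ⟨P, p, hp⟩ := hXY.contravariantlyFinite M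
    exact ⟨P, p, hp.1, hXY.epi_of_isRightApproximation p hp⟩
  have h₁ := isDegreewiseSplitThick_termwise X
  have h₂ := isDegreewiseSplitThick_relAcyclic X
  have h₃ := isDegreewiseSplitThick_termwiseRelAcyclic X
  have ht₂ := h₂.isTriangulated
  have H₁ := exists_orthogonal_preenvelope_of_coproducts h₁
    (termwise_coproduct (isClosedUnderCoproducts_of_rightApproximation
      hXY.contravariantlyFinite)) hV (fun M n _ _ =>
      stalk_mem_extensionProduct_termwise (fun M => by
        obtain ⟨K, e, hK, hK', -⟩ := hXY.exists_resolution M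
        exact ⟨K, e, hK, hK'⟩) M n)
  have H₂ := exists_orthogonal_preenvelope_of_products h₂ (relAcyclic_pi X) (fun M n _ _ =>
    stalk_mem_extensionProduct_relAcyclic hepi hXY.exists_resolution (fun N => by
        obtain ⟨K, e, hK, hK', -⟩ := hXY.exists_coresolution N
        exact ⟨K, e, hK, hK'⟩) M n)
  have hle : (homotopyClass (relAcyclic X)) ≤
      (homotopyClass (termwiseRelAcyclic X)).extensionProduct
      (homotopyClass (termwiseRelAcyclic X)).rightOrthogonal := by
    rintro Z ⟨K, hK, ⟨e⟩⟩
    refine ObjectProperty.prop_of_iso _ e ?_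
    obtain ⟨_, W, f, g, h, hT, ⟨P, hP, ⟨e'⟩⟩, hW⟩ := H₁ K
    -- `W` is orthogonal to all complexes with terms in `X`, hence right `X`-acyclic; so is `K`, and
    -- two out of three makes `P` acyclic as well.
    have hW' : homotopyClass (relAcyclic X) W := by
      obtain ⟨W, rfl⟩ := HomotopyCategory.quotient_obj_surjective W
      exact ObjectProperty.prop_map_obj _ _ (relAcyclic_of_rightOrthogonal X W
        ((rightOrthogonal_homotopyClass_iff _ _).1 hW))
    have hU := (homotopyClass (relAcyclic X)).ext_of_isTriangulatedClosed₁ _ hT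
      (ObjectProperty.prop_map_obj _ _ hK) hW'
    obtain ⟨Q, hQ, ⟨e''⟩⟩ := hU
    refine ⟨_, _, _, _, _, hT, ⟨P, ⟨hP, ?_⟩, ⟨e'⟩⟩, fun L f hL => hW f ?_⟩
    · exact relAcyclic_of_homotopyEquiv X
        (HomotopyCategory.homotopyEquivOfIso (e'' ≪≫ e'.symm)) hQ
    · exact ObjectProperty.map_monotone (fun _ h => h.1) _ _ hL
  have hM := H₂ M
  have hM' : (homotopyClass (termwiseRelAcyclic X)).extensionProduct
      (homotopyClass (termwiseRelAcyclic X)).rightOrthogonal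
        ((HomotopyCategory.quotient C (.up ℤ)).obj M) := by
    have := ObjectProperty.monotone_extensionProduct_left
      (homotopyClass (relAcyclic X)).rightOrthogonal hle _ hM
    -- The product is rebracketed so that the two orthogonal factors stand together; the second lies
    -- in the first because orthogonals reverse inclusions.
    rw [ObjectProperty.extensionProduct_assoc] at this
    refine ObjectProperty.monotone_extensionProduct_right _ ?_ _ this
    refine le_trans (ObjectProperty.monotone_extensionProduct_right _ ?_)
      (extensionProduct_self_le _)
    exact fun Z hZ L f hL => hZ f (ObjectProperty.map_monotone (fun _ h => h.2) _ _ hL)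
  obtain ⟨V, U, f, g, zero, σ, hV, hU⟩ := (extensionProduct_rightOrthogonal_iff h₃ M).1 hM'
  exact ⟨V, U, f, g, zero, σ, (rightOrthogonal_homotopyClass_iff _ _).1 hV, hU⟩

end

end CochainComplex

/-! ### Conflations and vanishing of `Ext¹`. -/

section RelativeExactness

variable {A : Type u} [Category.{v} A] [Abelian A] {X : ObjectProperty A}

lemma CategoryTheory.ShortComplex.Splitting.relativeShortExact {S : ShortComplex A}
    (σ : S.Splitting) : relativeShortExact X S :=
  ⟨σ.shortExact, fun _ _ => (σ.map _).shortExact⟩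

/-- The identity of `S.X₃` lifts along `S.g`, since `Hom(S.X₃, -)` keeps the sequence exact. -/
lemma relativeShortExact.nonempty_splitting {S : ShortComplex A} (hS : relativeShortExact X S)
    (h : X S.X₃) : Nonempty S.Splitting := by
  obtain ⟨s, hs⟩ := (AddCommGrpCat.epi_iff_surjective _).1 (hS.2 _ h).epi_g (𝟙 S.X₃)
  exact ⟨.ofExactOfSection S hS.1.exact s hs hS.1.mono_f⟩

lemma shortExact_of_isPushout {K D M N Q : A} {i : K ⟶ D} {p : D ⟶ M} {a : K ⟶ N}
    {inl : D ⟶ Q} {inr : N ⟶ Q} (sq : IsPushout i a inl inr) {zero : i ≫ p = 0}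
    (h : (ShortComplex.mk i p zero).ShortExact) {q : Q ⟶ M} (hq : inl ≫ q = p)
    (hq' : inr ≫ q = 0) : (ShortComplex.mk inr q hq').ShortExact := by
  have : Mono i := h.mono_f
  have : Epi p := h.epi_g
  have : Epi q := epi_of_epi_fac hq
  refine { exact := ShortComplex.exact_of_g_is_cokernel _ ?_, mono_f := ?_, epi_g := this }
  · refine CokernelCofork.IsColimit.ofπ' _ _ fun {T} x hx => ?_
    refine ⟨h.exact.desc (inl ≫ x) (by
      dsimp at hx ⊢
      rw [reassoc_of% sq.w, hx, comp_zero]), sq.hom_ext ?_ ?_⟩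
    · rw [reassoc_of% hq]
      exact h.exact.g_desc _ _
    · dsimp at hx ⊢
      rw [reassoc_of% hq', zero_comp, hx]
  · exact Abelian.mono_inr_of_isColimit _ _ sq.isColimit

/-- An extension equivalent to the biproduct inherits its section; conversely, any two split
extensions are isomorphic through the biproduct. -/
lemma subsingleton_extOne_iff (M N : ChainComplex A ℤ) :
    Subsingleton ((chainExactStructure X).ExtOne M N) ↔
      ∀ (Z : ChainComplex A ℤ) (i : N ⟶ Z) (p : Z ⟶ M) (zero : i ≫ p = 0),
        chainRelativeShortExact X (ShortComplex.mk i p zero) → ∃ s, s ≫ p = 𝟙 M := by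
  constructor
  · intro h Z i p zero hZ
    let e : (chainExactStructure X).Extension M N := ⟨Z, i, p, zero, hZ⟩
    let e' : (chainExactStructure X).Extension M N := ⟨N ⊞ M, biprod.inl, biprod.snd, by simp,
      fun n => ((ShortComplex.Splitting.ofHasBinaryBiproduct N M).map
        (HomologicalComplex.eval A _ n)).relativeShortExact⟩
    obtain ⟨φ, -, hφ⟩ := Quotient.exact (h.elim ⟦e'⟧ ⟦e⟧)
    refine ⟨biprod.inr ≫ φ.hom, ?_⟩
    change φ.hom ≫ p = biprod.snd at hφ
    simp [hφ]
  · intro h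
    have hs (e : (chainExactStructure X).Extension M N) :
        Nonempty (ShortComplex.mk e.ι e.π e.zero).Splitting := by
      obtain ⟨s, hs⟩ := h _ _ _ _ e.conflation
      have he := ((chainRelativeShortExact_iff X _).1 e.conflation).1
      exact ⟨.ofExactOfSection _ he.exact s hs he.mono_f⟩
    refine ⟨?_⟩
    rintro ⟨e⟩ ⟨e'⟩
    obtain ⟨σ⟩ := hs e
    obtain ⟨σ'⟩ := hs e'
    refine Quotient.sound ⟨σ.isoBinaryBiproduct ≪≫ σ'.isoBinaryBiproduct.symm, ?_, ?_⟩
    · have h₁ : e.ι ≫ σ.r = 𝟙 N := σ.f_r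
      change e.ι ≫ biprod.lift σ.r e.π ≫ biprod.desc e'.ι σ'.s = e'.ι
      rw [biprod.lift_desc, Preadditive.comp_add, reassoc_of% h₁, reassoc_of% e.zero, zero_comp,
        add_zero]
    · have h₁ : σ'.s ≫ e'.π = 𝟙 M := σ'.s_g
      change (biprod.lift σ.r e.π ≫ biprod.desc e'.ι σ'.s) ≫ e'.π = e.π
      rw [biprod.lift_desc, Preadditive.add_comp, Category.assoc, Category.assoc, h₁, e'.zero,
        comp_zero, zero_add, Category.comp_id]

end RelativeExactness

namespace CochainComplex

variable {A : Type u} [Category.{v} A] [Abelian A]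

/-- A degreewise split epimorphism of complexes which has a section up to homotopy has
a section. -/
lemma exists_section_of_homotopy {S : ShortComplex (CochainComplex A ℤ)}
    (σ : ∀ n, Nonempty (S.map (HomologicalComplex.eval A _ n)).Splitting) (s : S.X₃ ⟶ S.X₂)
    (H : Homotopy (s ≫ S.g) (𝟙 _)) : ∃ t : S.X₃ ⟶ S.X₂, t ≫ S.g = 𝟙 _ := by
  choose τ hτ using show ∀ n, ∃ τ : S.X₃.X n ⟶ S.X₂.X n, τ ≫ S.g.f n = 𝟙 _ from
    fun n => ⟨(σ n).some.s, (σ n).some.s_g⟩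
  -- Lifting the homotopy through the degreewise sections gives a nullhomotopic map whose
  -- subtraction from `s` makes the section strict.
  let h (i j : ℤ) : S.X₃.X i ⟶ S.X₂.X j := H.hom i j ≫ τ j
  refine ⟨s - Homotopy.nullHomotopicMap h, ?_⟩
  ext n
  have := H.comm n
  rw [dNext_eq _ (i' := n + 1) (by simp), prevD_eq _ (j' := n - 1) (by simp)] at this
  rw [Preadditive.sub_comp, HomologicalComplex.sub_f_apply, this, HomologicalComplex.comp_f,
    Homotopy.nullHomotopicMap_f (k₂ := n - 1) (k₀ := n + 1) (by simp) (by simp)]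
  simp only [h, Preadditive.add_comp, Category.assoc, ← S.g.comm, reassoc_of% hτ, hτ,
    Category.comp_id, add_sub_cancel_left]

end CochainComplex

/-! ### From the homotopy category of cochain complexes to `Ext¹` of chain complexes. -/

section ChainTransport

variable {A : Type u} [Category.{v} A] [Abelian A]

open CochainComplex Pretriangulated

lemma IsDegreewiseSplitThick.isClosedUnderIsomorphisms {P : ObjectProperty (CochainComplex A ℤ)}
    (hP : IsDegreewiseSplitThick P) : P.IsClosedUnderIsomorphisms where
  of_iso {K L} e hK := by
    obtain ⟨Z, hZ, h⟩ := hP.zero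
    -- An isomorphic copy of `K` is a split extension of `K` by a zero object.
    let S : ShortComplex (CochainComplex A ℤ) := ShortComplex.mk (0 : Z ⟶ L) e.inv zero_comp
    exact hP.ext S (fun n => ⟨ShortComplex.Splitting.map
      { r := (0 : L ⟶ Z), s := e.hom, f_r := hZ.eq_of_src _ _ } _⟩) h hK

/-- A section of the projection of the cone makes the third morphism of the triangle epi, which
forces `f` to vanish up to homotopy. -/
lemma rightOrthogonal_homotopyClass_of_section {P : ObjectProperty (CochainComplex A ℤ)}
    {K : CochainComplex A ℤ} (h : ∀ (L : CochainComplex A ℤ) (f : L ⟶ K), P L →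
      ∃ s : L⟦(1 : ℤ)⟧ ⟶ mappingCone f, s ≫ (mappingCone.triangle f).mor₃ = 𝟙 (L⟦(1 : ℤ)⟧)) :
    (homotopyClass P).rightOrthogonal ((HomotopyCategory.quotient A (.up ℤ)).obj K) := by
  rw [rightOrthogonal_homotopyClass_iff]
  intro L f hL
  obtain ⟨s, hs⟩ := h L f hL
  have hT := HomotopyCategory.mappingCone_triangleh_distinguished f
  have hs' : (HomotopyCategory.quotient A (.up ℤ)).map s ≫
      (HomotopyCategory.quotient A (.up ℤ)).map (mappingCone.triangle f).mor₃ = 𝟙 _ :=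
    ((HomotopyCategory.quotient A (.up ℤ)).map_comp _ _).symm.trans
      (((HomotopyCategory.quotient A (.up ℤ)).congr_map hs).trans
        ((HomotopyCategory.quotient A (.up ℤ)).map_id _))
  let c := ((HomotopyCategory.quotient A (.up ℤ)).commShiftIso (1 : ℤ)).app L
  have hc : (HomotopyCategory.quotient A (.up ℤ)).map s ≫ (mappingCone.triangleh f).mor₃ = c.hom :=
    (Category.assoc _ _ _).symm.trans ((congr_arg (· ≫ c.hom) hs').trans (Category.id_comp _))
  have : Epi (mappingCone.triangleh f).mor₃ := @epi_of_epi_fac _ _ _ _ _ _ _ c.hom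
    (IsIso.epi_of_iso c.hom) hc
  exact ⟨HomotopyCategory.homotopyOfEq _ _
    ((Triangle.mor₁_eq_zero_of_epi₃ _ hT this).trans
      ((HomotopyCategory.quotient A (.up ℤ)).map_zero _ _).symm)⟩

lemma exists_section_of_rightOrthogonal {P : ObjectProperty (CochainComplex A ℤ)}
    (hP : IsDegreewiseSplitThick P) {K L M : CochainComplex A ℤ} {f : K ⟶ L} {g : L ⟶ M}
    (zero : f ≫ g = 0) (σ : ∀ n, Nonempty ((ShortComplex.mk f g zero).map
      (HomologicalComplex.eval A _ n)).Splitting)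
    (h₁ : (homotopyClass P).rightOrthogonal ((HomotopyCategory.quotient A (.up ℤ)).obj K))
    (h₃ : P M) : ∃ s : M ⟶ L, s ≫ g = 𝟙 M := by
  have := hP.isTriangulated
  have hT : CochainComplex.trianglehOfDegreewiseSplit _ (fun n => (σ n).some) ∈
      distTriang (HomotopyCategory A (.up ℤ)) :=
    (HomotopyCategory.distinguished_iff_iso_trianglehOfDegreewiseSplit _).2 ⟨_, _, ⟨Iso.refl _⟩⟩
  obtain ⟨t, ht⟩ := Triangle.coyoneda_exact₃ _ hT (𝟙 _) (by
    rw [Category.id_comp]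
    exact (homotopyClass P).rightOrthogonal.le_shift 1 _ h₁ _ (P.prop_map_obj _ h₃))
  obtain ⟨s, hs⟩ : ∃ s : M ⟶ L, (HomotopyCategory.quotient A (.up ℤ)).map s = t :=
    (HomotopyCategory.quotient A (.up ℤ)).map_surjective t
  refine exists_section_of_homotopy σ s (HomotopyCategory.homotopyOfEq (s ≫ g) (𝟙 M) ?_)
  rw [Functor.map_comp, CategoryTheory.Functor.map_id, hs]
  exact ht.symm

variable {X : ObjectProperty A}

/-- A map `f : L ⟶ N` gives the degreewise split extension of `L[1]` by `N` on the cone, and its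
splitting makes `f` nullhomotopic. Conversely `hPX` makes every conflation ending in `P` degreewise
split, so its class is a map to `N[1]` in the homotopy category. -/
lemma rightOrthogonal_inverseImage_iff {P : ObjectProperty (CochainComplex A ℤ)}
    (hP : IsDegreewiseSplitThick P) (hPX : P ≤ termwise X) (N : ChainComplex A ℤ) :
    (chainExactStructure X).rightOrthogonal
      (P.inverseImage (ChainComplex.cochainComplexEquivalence A).functor) N ↔
    (homotopyClass P).rightOrthogonal ((HomotopyCategory.quotient A (.up ℤ)).obj
      ((ChainComplex.cochainComplexEquivalence A).functor.obj N)) := by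
  have := hP.isClosedUnderIsomorphisms
  let e := ChainComplex.cochainComplexEquivalence A
  refine ⟨fun h => rightOrthogonal_homotopyClass_of_section fun L f hL => ?_, fun h M hM => ?_⟩
  · obtain ⟨i, p, zero, hp, σ⟩ : ∃ (i : e.functor.obj N ⟶ mappingCone f)
        (p : mappingCone f ⟶ L⟦(1 : ℤ)⟧) (zero : i ≫ p = 0), p = (mappingCone.triangle f).mor₃ ∧
        ∀ n, Nonempty ((ShortComplex.mk i p zero).map (HomologicalComplex.eval A _ n)).Splitting :=
      ⟨_, _, _, rfl, fun n => ⟨mappingCone.triangleRotateShortComplexSplitting f n⟩⟩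
    have zero' : (e.unitIso.hom.app N ≫ e.inverse.map i) ≫ e.inverse.map p = 0 := by
      rw [Category.assoc, ← Functor.map_comp, zero, Functor.map_zero, comp_zero]
    let φ : (ShortComplex.mk i p zero).map e.inverse ≅ ShortComplex.mk _ _ zero' :=
      ShortComplex.isoMk (e.unitIso.symm.app N) (Iso.refl _) (Iso.refl _)
        ((e.unitIso.inv_hom_id_app_assoc N _).trans (Category.comp_id _).symm)
        ((Category.id_comp _).trans (Category.comp_id _).symm)
    obtain ⟨s, hs⟩ := (subsingleton_extOne_iff _ _).1 (h (e.inverse.obj (L⟦(1 : ℤ)⟧))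
        (P.prop_of_iso (e.counitIso.app _).symm (hP.shift _ _ hL))) _ _ _ zero'
      ((chainExactStructure X).closedUnderIso.of_iso φ
        (fun n => ShortComplex.Splitting.relativeShortExact (σ (-n)).some))
    obtain ⟨t, rfl⟩ := e.inverse.map_surjective s
    refine ⟨t, ?_⟩
    rw [← hp]
    exact e.inverse.map_injective ((e.inverse.map_comp _ _).trans
      (hs.trans (e.inverse.map_id _).symm))
  · refine (subsingleton_extOne_iff _ _).2 fun Z i p zero hZ => ?_
    obtain ⟨t, ht⟩ := exists_section_of_rightOrthogonal hP (f := e.functor.map i)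
      (g := e.functor.map p) (by rw [← Functor.map_comp, zero, Functor.map_zero]) (fun n =>
        (hZ (-n)).nonempty_splitting (hPX _ hM n)) h hM
    obtain ⟨s, rfl⟩ := e.functor.map_surjective t
    refine ⟨s, e.functor.map_injective ?_⟩
    rw [Functor.map_comp, CategoryTheory.Functor.map_id, ht]

lemma inverseImage_termwise [X.IsClosedUnderIsomorphisms] :
    (termwise X).inverseImage (ChainComplex.cochainComplexEquivalence A).functor =
      degreewise X := by
  ext K
  refine ⟨fun h n => X.prop_of_iso (K.XIsoOfEq (neg_neg n)) (h (-n)), fun h n => h (-n)⟩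

lemma inverseImage_termwiseRelAcyclic [X.IsClosedUnderIsomorphisms] :
    (termwiseRelAcyclic X).inverseImage (ChainComplex.cochainComplexEquivalence A).functor =
      degreewiseAcyclic X := by
  ext K
  refine and_congr (iff_of_eq (congr_fun inverseImage_termwise K)) ?_
  rw [isRightAcyclic_iff]
  constructor
  · intro h M hM i j k hi hk x hx
    obtain ⟨i, rfl⟩ : ∃ i', -i' = i := ⟨-i, neg_neg i⟩
    obtain ⟨j, rfl⟩ : ∃ i', -i' = j := ⟨-j, neg_neg j⟩
    obtain ⟨k, rfl⟩ : ∃ i', -i' = k := ⟨-k, neg_neg k⟩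
    simp only [ChainComplex.prev, ChainComplex.next] at hi hk
    exact h M hM i j k (by lia) (by lia) x hx
  · intro h M hM i j k hi hj x hx
    exact h M hM (-i) (-j) (-k) (by simp; lia) (by simp; lia) x hx

lemma isClosedUnderColimitsOfShape_rightOrthogonal [X.IsClosedUnderFiniteCoproducts]
    [X.IsClosedUnderIsomorphisms] {J : Type*} [Category* J]
    (h : ((chainExactStructure X).rightOrthogonal (degreewise X)).IsClosedUnderColimitsOfShape J) :
    ((homotopyClass (termwise X)).rightOrthogonal.inverseImage
      (HomotopyCategory.quotient A (.up ℤ))).IsClosedUnderColimitsOfShape J := by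
  refine (ObjectProperty.isClosedUnderColimitsOfShape_inverseImage_iff _ _
    (ChainComplex.cochainComplexEquivalence A)).1 ?_
  convert! h
  ext N
  rw [← inverseImage_termwise]
  exact (rightOrthogonal_inverseImage_iff (isDegreewiseSplitThick_termwise X) le_rfl N).symm

/-- Every complex is a quotient, in the relative exact structure, of a contractible complex with
terms in `X`. -/
lemma exists_termwiseRelAcyclic_cover [X.IsClosedUnderFiniteCoproducts]
    [X.IsClosedUnderIsomorphisms]
    (hX : ∀ M : A, ∃ (M₀ : A) (f : M₀ ⟶ M), IsRightApproximation X f) (M : CochainComplex A ℤ) :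
    ∃ (D : CochainComplex A ℤ) (p : D ⟶ M), termwiseRelAcyclic X D ∧
      ∀ (n : ℤ) (P : A), X P → ∀ x : P ⟶ M.X n, ∃ y, y ≫ p.f n = x := by
  choose P π hπ using hX
  -- The shift by one makes the summand `Q.X (n + 1)` of the cone of `𝟙 Q` approximate `M.X n` in
  -- degree `n`. As `Q` has zero differential, `β` is forced to be `α` followed by the differential
  -- of `M`.
  let Q : CochainComplex A ℤ := { X n := P (M.X (n - 1)), d _ _ := 0 }
  have hQ : termwise X Q := fun n => (hπ _).1
  let α : HomComplex.Cochain Q M (-1) := HomComplex.Cochain.mk fun p q hpq =>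
    π (M.X (p - 1)) ≫ (M.XIsoOfEq (by lia)).hom
  let β : Q ⟶ M :=
    { f n := π (M.X (n - 1)) ≫ M.d (n - 1) n
      comm' i j _ := by simp [Q] }
  let p := mappingCone.desc (𝟙 Q) α β (by
    ext n
    rw [HomComplex.δ_v (-1) 0 (by lia) _ n n (by lia) (n - 1) (n + 1) rfl rfl]
    simp [α, β, Q, HomComplex.Cochain.mk_v])
  refine ⟨_, p, ⟨(isDegreewiseSplitThick_termwise X).mappingCone (𝟙 Q) hQ hQ, ?_⟩, ?_⟩
  · have h0 := (isDegreewiseSplitThick_relAcyclic X)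
    obtain ⟨Z, hZ, h⟩ := h0.zero
    have hc : IsZero ((HomotopyCategory.quotient A (.up ℤ)).obj (mappingCone (𝟙 Q))) :=
      Triangle.isZero₃_of_isIso₁ _ (HomotopyCategory.mappingCone_triangleh_distinguished (𝟙 Q))
        (inferInstanceAs (IsIso ((HomotopyCategory.quotient A (.up ℤ)).map (𝟙 Q))))
    exact relAcyclic_of_homotopyEquiv X (HomotopyCategory.homotopyEquivOfIso
      (((HomotopyCategory.quotient A (.up ℤ)).map_isZero hZ).iso hc)) h
  · intro n L hL x
    obtain ⟨y, hy⟩ := (hπ (M.X (n + 1 - 1))).2 L (x ≫ (M.XIsoOfEq (by lia)).hom) hL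
    refine ⟨y ≫ (mappingCone.inl (𝟙 Q)).v (n + 1) n (by lia), ?_⟩
    rw [Category.assoc, mappingCone.inl_v_desc_f, HomComplex.Cochain.mk_v, reassoc_of% hy]
    simp

end ChainTransport

/-! ### Completeness of the cotorsion pair. -/

section CotorsionPair

variable {A : Type u} [Category.{v} A] [Abelian A] {X Y : ObjectProperty A}

lemma degreewiseAcyclic_of_retract [X.IsStableUnderRetracts] {K L : ChainComplex A ℤ}
    (h : Retract K L) (hL : degreewiseAcyclic X L) : degreewiseAcyclic X K := by
  refine ⟨fun n => X.prop_of_retract (h.map (HomologicalComplex.eval A _ n)) (hL.1 n), ?_⟩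
  have hr (n : ℤ) : h.i.f n ≫ h.r.f n = 𝟙 _ := by
    rw [← HomologicalComplex.comp_f, h.retract, HomologicalComplex.id_f]
  have hL := hL.2
  rw [isRightAcyclic_iff] at hL ⊢
  intro M hM i j k hi hk x hx
  obtain ⟨y, hy⟩ := hL M hM i j k hi hk (x ≫ h.i.f j) (by
    rw [Category.assoc, h.i.comm, reassoc_of% hx, zero_comp])
  exact ⟨y ≫ h.r.f i, by rw [Category.assoc, h.r.comm, reassoc_of% hy, hr, Category.comp_id]⟩

/-- Special preenvelopes: every chain complex `M` fits in a short exact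
sequence `M ↣ V ↠ U` of `Ch(A, 𝓔)` with `U` acyclic with terms in `X` and `V` orthogonal
to such complexes. -/
lemma exists_degreewiseAcyclic_preenvelope [HasLimitsOfShape (Discrete ℕ) A]
    [HasColimitsOfShape (Discrete ℕ) A]
    [X.IsClosedUnderFiniteCoproducts] [Y.IsClosedUnderFiniteCoproducts]
    [X.IsStableUnderRetracts] [Y.IsClosedUnderIsomorphisms] (hXY : IsAdmissibleBalancedPair X Y)
    (hsum : ((chainExactStructure X).rightOrthogonal
      (degreewise X)).IsClosedUnderColimitsOfShape (Discrete ℕ))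
    (M : ChainComplex A ℤ) :
    ∃ (V U : ChainComplex A ℤ) (i : M ⟶ V) (p : V ⟶ U) (zero : i ≫ p = 0),
      degreewiseAcyclic X U ∧ (chainExactStructure X).rightOrthogonal (degreewiseAcyclic X) V ∧
        chainRelativeShortExact X (ShortComplex.mk i p zero) := by
  let e := ChainComplex.cochainComplexEquivalence A
  have := isClosedUnderColimitsOfShape_rightOrthogonal hsum
  obtain ⟨V, U, f, g, zero, σ, hV, hU⟩ :=
    CochainComplex.exists_termwiseRelAcyclic_preenvelope hXY (fun V hV =>
      ObjectProperty.prop_colimit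
        ((homotopyClass (CochainComplex.termwise X)).rightOrthogonal.inverseImage
        (HomotopyCategory.quotient A (.up ℤ))) _ (fun j => hV j.as)) (e.functor.obj M)
  have hP := CochainComplex.isDegreewiseSplitThick_termwiseRelAcyclic X
  have := hP.isClosedUnderIsomorphisms
  have zero' : (e.unitIso.hom.app M ≫ e.inverse.map f) ≫ e.inverse.map g = 0 := by
    rw [Category.assoc, ← Functor.map_comp, zero, Functor.map_zero, comp_zero]
  let φ : (ShortComplex.mk f g zero).map e.inverse ≅ ShortComplex.mk _ _ zero' :=
    ShortComplex.isoMk (e.unitIso.symm.app M) (Iso.refl _) (Iso.refl _)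
      ((e.unitIso.inv_hom_id_app_assoc M _).trans (Category.comp_id _).symm)
      ((Category.id_comp _).trans (Category.comp_id _).symm)
  refine ⟨_, _, _, _, zero', ?_, ?_, (chainExactStructure X).closedUnderIso.of_iso φ
    (fun n => ShortComplex.Splitting.relativeShortExact (σ (-n)).some)⟩
  · rw [← inverseImage_termwiseRelAcyclic]
    exact (CochainComplex.termwiseRelAcyclic X).prop_of_iso (e.counitIso.app _).symm hU
  · rw [← inverseImage_termwiseRelAcyclic, rightOrthogonal_inverseImage_iff hP fun _ h => h.1]
    refine ObjectProperty.prop_of_iso _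
      ((HomotopyCategory.quotient A (.up ℤ)).mapIso (e.counitIso.app V)).symm ?_
    exact (rightOrthogonal_homotopyClass_iff _ _).2 hV

/-- Salce's argument: special preenvelopes and covers by objects of the left class give
special precovers. -/
lemma exists_degreewiseAcyclic_precover
    [X.IsClosedUnderFiniteCoproducts] [X.IsClosedUnderIsomorphisms]
    (hXapp : ∀ M : A, ∃ (M₀ : A) (f : M₀ ⟶ M), IsRightApproximation X f)
    (hXepi : ∀ {M₀ M : A} (f : M₀ ⟶ M), IsRightApproximation X f → Epi f)
    {G : ObjectProperty (ChainComplex A ℤ)}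
    (hG : ∀ M : ChainComplex A ℤ,
      ∃ (V U : ChainComplex A ℤ) (i : M ⟶ V) (p : V ⟶ U) (zero : i ≫ p = 0),
        degreewiseAcyclic X U ∧ G V ∧ chainRelativeShortExact X (ShortComplex.mk i p zero))
    (M : ChainComplex A ℤ) :
    ∃ (V U : ChainComplex A ℤ) (i : V ⟶ U) (p : U ⟶ M) (zero : i ≫ p = 0),
      degreewiseAcyclic X U ∧ G V ∧ chainRelativeShortExact X (ShortComplex.mk i p zero) := by
  let e := ChainComplex.cochainComplexEquivalence A
  have hP := CochainComplex.isDegreewiseSplitThick_termwiseRelAcyclic X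
  have := hP.isClosedUnderIsomorphisms
  obtain ⟨D, p, hD, hp⟩ : ∃ (D : ChainComplex A ℤ) (p : D ⟶ M), degreewiseAcyclic X D ∧
      ∀ (n : ℤ) (P : A), X P → ∀ x : P ⟶ M.X n, ∃ y, y ≫ p.f n = x := by
    obtain ⟨D, p, hD, hp⟩ := exists_termwiseRelAcyclic_cover hXapp (e.functor.obj M)
    refine ⟨e.inverse.obj D, e.inverse.map p ≫ e.unitIso.inv.app M, ?_, fun n P hP x => ?_⟩
    · rw [← inverseImage_termwiseRelAcyclic]
      exact (CochainComplex.termwiseRelAcyclic X).prop_of_iso (e.counitIso.app _).symm hD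
    · let ε := (HomologicalComplex.eval A _ n).mapIso (e.unitIso.app M)
      obtain ⟨y, hy⟩ := hp (-n) P hP (x ≫ ε.hom)
      refine ⟨y, ?_⟩
      exact (Category.assoc y (p.f (-n)) ε.inv).symm.trans
        ((congr_arg (· ≫ ε.inv) hy).trans ((Category.assoc _ _ _).trans
          ((congr_arg (x ≫ ·) ε.hom_inv_id).trans (Category.comp_id x))))
  have hpepi : Epi p := HomologicalComplex.epi_of_epi_f _ fun n => by
    obtain ⟨P, f, hf⟩ := hXapp (M.X n)
    have := hXepi f hf
    obtain ⟨y, hy⟩ := hp n P hf.1 f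
    exact epi_of_epi_fac hy
  have hK : (ShortComplex.mk _ _ (kernel.condition p)).ShortExact :=
    { exact := ShortComplex.exact_kernel p, mono_f := by dsimp; infer_instance, epi_g := hpepi }
  obtain ⟨V, U, i, q, zero, hU, hV, hiq⟩ := hG (kernel p)
  have hiq' := ((chainRelativeShortExact_iff X _).1 hiq).1
  -- The pushout `Q` lies in two sequences: `V ⟶ Q ⟶ M` is the precover, and `D ⟶ Q ⟶ U` puts `Q` in
  -- the left class.
  obtain ⟨Q, a, b, sq⟩ : ∃ (Q : ChainComplex A ℤ) (a : D ⟶ Q) (b : V ⟶ Q),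
      IsPushout (kernel.ι p) i a b := ⟨_, _, _, .of_hasPushout _ _⟩
  have w₁ : kernel.ι p ≫ p = i ≫ (0 : V ⟶ M) := by simp
  have w₂ : kernel.ι p ≫ (0 : D ⟶ U) = i ≫ q := by rw [zero, comp_zero]
  have h₁ := shortExact_of_isPushout sq hK (sq.inl_desc _ _ w₁) (sq.inr_desc _ _ w₁)
  have h₂ := shortExact_of_isPushout sq.flip hiq' (sq.inr_desc _ _ w₂) (sq.inl_desc _ _ w₂)
  refine ⟨_, _, _, _, _, ?_, hV, (chainRelativeShortExact_iff X _).2 ⟨h₁, fun P => ?_⟩⟩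
  · rw [← inverseImage_termwiseRelAcyclic] at hU hD ⊢
    refine hP.ext ((ShortComplex.mk _ _ (sq.inl_desc _ _ w₂)).map e.functor) (fun n => ?_) hD hU
    have hn := (HomologicalComplex.shortExact_iff_degreewise_shortExact _).1 h₂ (-n)
    -- The terms of `U` lie in `X`, so `V ⟶ U` splits degreewise; pushing its section along `b`
    -- splits `Q ⟶ U`.
    obtain ⟨σ⟩ := (hiq (-n)).nonempty_splitting (hU.1 n)
    refine ⟨.ofExactOfSection _ hn.exact (σ.s ≫ b.f (-n)) ?_ hn.mono_f⟩
    have := congr_arg (fun φ => HomologicalComplex.Hom.f φ (-n)) (sq.inr_desc _ _ w₂)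
    exact (Category.assoc σ.s (b.f (-n)) ((sq.desc _ _ w₂).f (-n))).trans
      ((congr_arg (σ.s ≫ ·) this).trans σ.s_g)
  · refine (AddCommGrpCat.epi_iff_surjective _).2 fun x => ?_
    obtain ⟨y, hy⟩ := hp P.2 P.1.1 P.1.2 x
    refine ⟨y ≫ a.f P.2, ?_⟩
    have := congr_arg (fun φ => HomologicalComplex.Hom.f φ P.2) (sq.inl_desc _ _ w₁)
    change (y ≫ a.f P.2) ≫ (sq.desc _ _ w₁).f P.2 = _
    rw [Category.assoc]
    exact (congr_arg (y ≫ ·) this).trans hy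

end CotorsionPair

theorem proposition3p8 {A : Type u} [Category.{v} A] [Abelian A]
    [HasLimits A] [HasColimits A] [AB5 A]
    (X Y : ObjectProperty A)
    [X.IsClosedUnderFiniteCoproducts] [Y.IsClosedUnderFiniteCoproducts]
    [X.IsStableUnderRetracts] [Y.IsClosedUnderIsomorphisms]
    (hXY : IsAdmissibleBalancedPair X Y)
    (hsum : ∀ J : Type v,
      ((chainExactStructure X).rightOrthogonal
        (degreewise X)).IsClosedUnderColimitsOfShape (Discrete J)) :
    (chainExactStructure X).IsCompleteCotorsionPair (degreewiseAcyclic X)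
      ((chainExactStructure X).rightOrthogonal (degreewiseAcyclic X)) := by
  have : HasLimitsOfSize.{0, 0} A := hasLimitsOfSizeShrink.{0, 0, v, v} A
  have : HasColimitsOfSize.{0, 0} A := hasColimitsOfSizeShrink.{0, 0, v, v} A
  -- Countable sums suffice for the telescopes; `ULift` only moves the index set to universe `v`.
  have := hsum (ULift ℕ)
  have hpre := exists_degreewiseAcyclic_preenvelope hXY
    (.of_equivalence (Discrete.equivalence Equiv.ulift.{v}))
  have hcov := exists_degreewiseAcyclic_precover hXY.contravariantlyFinite
    hXY.epi_of_isRightApproximation hpre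
  refine
    { left_eq := ?_
      right_eq := rfl
      exists_precover := hcov
      exists_preenvelope := fun M => ?_ }
  -- The special precover of an object of the left orthogonal splits, so the object is a retract of
  -- one in the left class.
  · refine le_antisymm (fun F hF N hN => hN F hF) fun M hM => ?_
    obtain ⟨V, U, i, p, zero, hU, hV, hip⟩ := hcov M
    obtain ⟨s, hs⟩ := (subsingleton_extOne_iff _ _).1 (hM V hV) U i p zero hip
    exact degreewiseAcyclic_of_retract ⟨s, p, hs⟩ hU
  · obtain ⟨V, U, i, p, zero, h⟩ := hpre M
    exact ⟨V, U, i, p, zero, h⟩
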